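/- Let $p$ be a prime and let $n>d\ge 2$ be integers with $d<p$. Assume that at least one of the following holds: - $p\equiv 1 \pmod d$ and $n\cdot\frac{p-1}{d}$ is even; - $p\equiv -1 \pmod d$ and $n\cdot\frac{p+1}{d}$ is even. Then there exist integers $B,C$, depending only on $p,d,n$, with $0\le B\le p^{n-3}$, such that the following holds for every perfect field $K$ of characteristic $p$. Let $f=x_1^d+\cdots+x_n^d\in K[[x_1,\dots,x_n]]$ and $R=K[[x_1,\dots,x_n]]/(f)$. For $e\ge 0$ let $FS_f(e)$ be the F-signature function of $R$, that is, the maximal rank of a free $R$-module direct summand of $R^{1/p^e}$, where $R^{1/p^e}$ is the ring of $p^e$-th roots of elements of $R$. Then the F-signature $$s(f)=\lim_{e\to\infty}\frac{FS_f(e)}{p^{(n-1)e}}$$ exists and is the rational number $$s(f)=\frac{-C}{p^{n-1}-B},$$ and for every integer $e\ge 1$ $$FS_f(e)=s(f)\,p^{(n-1)e}+(1-s(f))\,B^e .$$ -/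

import Mathlib

/-- The `e`-fold Frobenius endomorphism `r ↦ r ^ (p ^ e)` of a commutative algebra `R` over a
field `K` of characteristic `p`. -/
def frobeniusPow (K R : Type*) [Field K] [CommRing R] [Algebra K R] (p e : ℕ) [Fact p.Prime]
    [CharP K p] : R →+* R where
  toFun r := r ^ p ^ e
  map_one' := one_pow _
  map_mul' x y := mul_pow x y _
  map_zero' := zero_pow (pow_ne_zero _ (Fact.out (p := p.Prime)).ne_zero)
  map_add' x y := by
    rcases subsingleton_or_nontrivial R with h | h
    · exact Subsingleton.elim _ _
    · have : CharP R p := charP_of_injective_algebraMap (algebraMap K R).injective p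
      exact add_pow_char_pow x y p e

/-- The ring `R^{1/p^e}` of `p^e`-th roots of elements of a reduced algebra `R` over a field `K` of
characteristic `p`. Its underlying ring is a copy of `R`, the copy of `r` being the root
`r^{1/p^e}`. -/
def RootRing (_K R : Type*) (_p _e : ℕ) : Type _ := R

instance (K R : Type*) [CommRing R] (p e : ℕ) : CommRing (RootRing K R p e) :=
  inferInstanceAs (CommRing R)

/-- The extension `R → R^{1/p^e}`, `r ↦ r = (r^{p^e})^{1/p^e}`. -/
noncomputable instance (K R : Type*) [Field K] [CommRing R] [Algebra K R] (p e : ℕ)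
    [Fact p.Prime] [CharP K p] : Algebra R (RootRing K R p e) :=
  (frobeniusPow K R p e : R →+* RootRing K R p e).toAlgebra

/-- The `R`-module `M` has a direct summand that is free of rank `m`. -/
def HasFreeSummand (R M : Type*) [CommRing R] [AddCommGroup M] [Module R M] (m : ℕ) : Prop :=
  ∃ (i : (Fin m → R) →ₗ[R] M) (q : M →ₗ[R] (Fin m → R)), q ∘ₗ i = LinearMap.id

/-- The maximal rank of a free direct summand of `M` (for `M` finitely generated over a nontrivial
ring `R` the set of these ranks is bounded, and it contains `0`). -/
noncomputable def freeRank (R M : Type*) [CommRing R] [AddCommGroup M] [Module R M] : ℕ :=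
  sSup {m : ℕ | HasFreeSummand R M m}

/-- The hypersurface ring `K⟦x_1, …, x_n⟧ / (f)`. -/
abbrev HypersurfaceRing {K : Type*} [Field K] {n : ℕ} (f : MvPowerSeries (Fin n) K) : Type _ :=
  MvPowerSeries (Fin n) K ⧸ Ideal.span {f}

/-- The F-signature function of `R = K⟦x_1, …, x_n⟧ / (f)`: its value at `e` is the maximal rank of
a free `R`-summand of `R^{1/p^e}`. -/
noncomputable def FS (p : ℕ) [Fact p.Prime] {K : Type*} [Field K] [CharP K p] {n : ℕ}
    (f : MvPowerSeries (Fin n) K) (e : ℕ) : ℕ :=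
  freeRank (HypersurfaceRing f) (RootRing K (HypersurfaceRing f) p e)

/-- `s` is the F-signature of the `(n - 1)`-dimensional ring `K⟦x_1, …, x_n⟧ / (f)`: the leading
coefficient of the F-signature function, `s = lim_{e → ∞} FS(e) / p^{(n - 1) e}`. -/
def IsFSignature (p : ℕ) [Fact p.Prime] {K : Type*} [Field K] [CharP K p] {n : ℕ}
    (f : MvPowerSeries (Fin n) K) (s : ℝ) : Prop :=
  Filter.Tendsto (fun e : ℕ => (FS p f e : ℝ) / (p : ℝ) ^ ((n - 1) * e)) Filter.atTop (nhds s)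

/-- The Fermat hypersurface `x_1^d + ⋯ + x_n^d`. -/
noncomputable def fermat (K : Type*) [Field K] (n d : ℕ) : MvPowerSeries (Fin n) K :=
  ∑ i : Fin n, MvPowerSeries.X i ^ d

/-! Write q = p^e. A Fedder-type criterion says that some R-linear map R^{1/q} → R sends g^{1/q} to
a unit exactly when f^{q-1} g is not in (x_1^q, …, x_n^q). Hence the F-signature function at e is
the rank of multiplication by f^{q-1} on K[x_1, …, x_n]/(x_i^q) (`FS_fermat_eq_finrank`). Since f^q
= 0 there, this rank is the number of Jordan blocks of the maximal size q for multiplication by f.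

For a Fermat f the quotient with this endomorphism is the n-th tensor power of (K[x]/(x^q), x^d),
where tensoring uses S ⊗ 1 + 1 ⊗ T. So the count takes place in the representation ring of nilpotent
endomorphisms studied by Han and Monsky. Let δ_k be the block of size k, λ_k = (-1)^k (δ_{k+1} -
δ_k) and ε = λ_{q-1}. Then ε² = 1, and the elements μ_j = ε^j λ_{qj} for j < p obey a fusion rule
that does not depend on e (`isFusionSequence_twist`).

Let c_q be the class of (K[x]/(x^q), x^d). If p = du ± 1 then c_{pq} = d δ_{qu} + (-ε)^u μ_v c_q,
with v = u or v = u - 1 (`powerClass_succ`). Here δ_{qu} is δ_q times a polynomial in μ_1, and δ_q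
turns c_q into the scalar q. In the n-th power the factor (-ε)^{un} is 1 by the parity hypothesis,
so c_{pq}^n = μ_v^n c_q^n + q^{n-1} A(μ_1) δ_q with A independent of e (`powerClass_succ_pow`).

Counting blocks of size pq in P(μ_1) x, for x built from blocks of size at most q, gives a fixed
coefficient of P times the number of blocks of size q in x (`functional_aeval_mul`). Thus FS(e+1) =
B FS(e) - C p^{(n-1)e} with FS(0) = 1, and solving this recursion gives the formula and the limit.
The constant B is an entry of a power of a 0/1 fusion matrix, which yields its bounds
(`fusionCoeff_pow_mem_Icc`). -/

open TensorProduct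

universe u

/-! ### Tensor products of endomorphisms -/

section TensorEndo

variable {K V W X V' W' : Type*} [Field K] [AddCommGroup V] [Module K V] [AddCommGroup W]
  [Module K W] [AddCommGroup X] [Module K X] [AddCommGroup V'] [Module K V'] [AddCommGroup W']
  [Module K W']

/-- The endomorphism `S ⊗ 1 + 1 ⊗ T`. -/
noncomputable def tensorEndo (S : Module.End K V) (T : Module.End K W) :
    Module.End K (V ⊗[K] W) := S.rTensor W + T.lTensor V

@[simp]
theorem tensorEndo_tmul (S : Module.End K V) (T : Module.End K W) (x : V) (y : W) :
    tensorEndo S T (x ⊗ₜ y) = S x ⊗ₜ y + x ⊗ₜ T y := rfl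

variable (S : Module.End K V) (T : Module.End K W) (U : Module.End K X)

theorem congr_tensorEndo {S' : Module.End K V'} {T' : Module.End K W'} (f : V ≃ₗ[K] V')
    (g : W ≃ₗ[K] W') (hf : ∀ x, f (S x) = S' (f x)) (hg : ∀ x, g (T x) = T' (g x)) (z : V ⊗[K] W) :
    TensorProduct.congr f g (tensorEndo S T z) = tensorEndo S' T' (TensorProduct.congr f g z) := by
  induction z with
  | zero => simp only [map_zero]
  | add x y hx hy => rw [map_add, map_add, hx, hy, map_add, map_add]
  | tmul x y => simp [hf, hg]

theorem comm_tensorEndo (z : V ⊗[K] W) :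
    TensorProduct.comm K V W (tensorEndo S T z) = tensorEndo T S (TensorProduct.comm K V W z) := by
  induction z with
  | zero => simp only [map_zero]
  | add x y hx hy => rw [map_add, map_add, hx, hy, map_add, map_add]
  | tmul x y => simp [add_comm]

theorem assoc_tensorEndo (z : (V ⊗[K] W) ⊗[K] X) :
    TensorProduct.assoc K V W X (tensorEndo (tensorEndo S T) U z) =
      tensorEndo S (tensorEndo T U) (TensorProduct.assoc K V W X z) := by
  refine LinearMap.congr_fun (f := (TensorProduct.assoc K V W X).toLinearMap ∘ₗ
    tensorEndo (tensorEndo S T) U) (g := tensorEndo S (tensorEndo T U) ∘ₗ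
    (TensorProduct.assoc K V W X).toLinearMap) (TensorProduct.ext_threefold fun x y z => ?_) z
  simp [add_tmul, tmul_add, add_assoc]

theorem lid_tensorEndo (z : K ⊗[K] V) :
    TensorProduct.lid K V (tensorEndo 0 S z) = S (TensorProduct.lid K V z) := by
  induction z with
  | zero => simp only [map_zero]
  | add x y hx hy => rw [map_add, map_add, hx, hy, map_add, map_add]
  | tmul x y => simp

theorem prodRight_tensorEndo (z : V ⊗[K] (W × X)) :
    TensorProduct.prodRight K K V W X (tensorEndo S (T.prodMap U) z) =
      (tensorEndo S T).prodMap (tensorEndo S U) (TensorProduct.prodRight K K V W X z) := by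
  induction z with
  | zero => simp only [map_zero]
  | add x y hx hy => rw [map_add, map_add, hx, hy, map_add, map_add]
  | tmul x y => simp

end TensorEndo

/-! ### The semiring of isomorphism classes of endomorphisms -/

/-- A finite-dimensional vector space with an endomorphism. -/
structure EndoSpace (K : Type u) [Field K] where
  carrier : Type u
  [grp : AddCommGroup carrier]
  [mod : Module K carrier]
  [fin : FiniteDimensional K carrier]
  endo : Module.End K carrier

namespace EndoSpace

attribute [instance] grp mod fin

variable {K : Type u} [Field K]

/-- Isomorphism of spaces with an endomorphism. -/
def Iso (M N : EndoSpace K) : Prop :=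
  ∃ f : M.carrier ≃ₗ[K] N.carrier, ∀ x, f (M.endo x) = N.endo (f x)

instance setoid (K : Type u) [Field K] : Setoid (EndoSpace K) where
  r := Iso
  iseqv :=
    { refl := fun _ => ⟨LinearEquiv.refl _ _, fun _ => rfl⟩
      symm := by
        rintro M N ⟨f, hf⟩
        exact ⟨f.symm, fun x => f.injective (by simp [hf])⟩
      trans := by
        rintro M N P ⟨f, hf⟩ ⟨g, hg⟩
        exact ⟨f.trans g, fun x => by simp [hf, hg]⟩ }

/-- The direct sum. -/
def sum (M N : EndoSpace K) : EndoSpace K :=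
  { carrier := M.carrier × N.carrier
    endo := M.endo.prodMap N.endo }

/-- The tensor product, with the endomorphism `S ⊗ 1 + 1 ⊗ T`. -/
noncomputable def tensor (M N : EndoSpace K) : EndoSpace K :=
  { carrier := M.carrier ⊗[K] N.carrier
    endo := tensorEndo M.endo N.endo }

theorem sum_congr {M M' N N' : EndoSpace K} (h : Iso M M') (h' : Iso N N') :
    Iso (M.sum N) (M'.sum N') := by
  obtain ⟨f, hf⟩ := h
  obtain ⟨g, hg⟩ := h'
  exact ⟨f.prodCongr g, fun x => Prod.ext (hf x.1) (hg x.2)⟩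

theorem tensor_congr {M M' N N' : EndoSpace K} (h : Iso M M') (h' : Iso N N') :
    Iso (M.tensor N) (M'.tensor N') := by
  obtain ⟨f, hf⟩ := h
  obtain ⟨g, hg⟩ := h'
  exact ⟨TensorProduct.congr f g, congr_tensorEndo _ _ f g hf hg⟩

/-- The one-dimensional space with zero endomorphism. -/
def unit (K : Type u) [Field K] : EndoSpace K := { carrier := K, endo := 0 }

/-- The zero space. -/
def null (K : Type u) [Field K] : EndoSpace K := { carrier := PUnit.{u + 1}, endo := 0 }

theorem iso_of_subsingleton (M N : EndoSpace K) [Subsingleton M.carrier]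
    [Subsingleton N.carrier] : Iso M N :=
  ⟨⟨0, 0, fun _ => Subsingleton.elim _ _, fun _ => Subsingleton.elim _ _⟩,
    fun _ => Subsingleton.elim _ _⟩

theorem tensor_comm (M N : EndoSpace K) : Iso (M.tensor N) (N.tensor M) :=
  ⟨TensorProduct.comm K _ _, comm_tensorEndo _ _⟩

theorem tensor_assoc (M N P : EndoSpace K) :
    Iso ((M.tensor N).tensor P) (M.tensor (N.tensor P)) :=
  ⟨TensorProduct.assoc K _ _ _, assoc_tensorEndo _ _ _⟩

theorem unit_tensor (M : EndoSpace K) : Iso ((unit K).tensor M) M :=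
  ⟨TensorProduct.lid K _, lid_tensorEndo (K := K) M.endo⟩

theorem tensor_sum (M N P : EndoSpace K) :
    Iso (M.tensor (N.sum P)) ((M.tensor N).sum (M.tensor P)) :=
  ⟨TensorProduct.prodRight K K M.carrier N.carrier P.carrier, prodRight_tensorEndo _ _ _⟩

instance : Unique (null K).carrier := inferInstanceAs (Unique PUnit)

instance (M : EndoSpace K) : Subsingleton ((null K).tensor M).carrier :=
  inferInstanceAs (Subsingleton (PUnit.{u + 1} ⊗[K] M.carrier))

theorem null_sum (M : EndoSpace K) : Iso ((null K).sum M) M :=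
  ⟨LinearEquiv.uniqueProd, fun _ => rfl⟩

end EndoSpace

/-- Isomorphism classes of finite-dimensional vector spaces with an endomorphism. -/
def EndoClass (K : Type u) [Field K] : Type (u + 1) := Quotient (EndoSpace.setoid K)

namespace EndoClass

open EndoSpace

variable {K : Type u} [Field K]

/-- The isomorphism class of `(V, T)`. -/
def mk {V : Type u} [AddCommGroup V] [Module K V] [FiniteDimensional K V] (T : Module.End K V) :
    EndoClass K := Quotient.mk _ { carrier := V, endo := T }

theorem mk_eq_mk {V W : Type u} [AddCommGroup V] [Module K V] [FiniteDimensional K V]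
    [AddCommGroup W] [Module K W] [FiniteDimensional K W] {T : Module.End K V}
    {T' : Module.End K W} (f : V ≃ₗ[K] W) (h : ∀ x, f (T x) = T' (f x)) : mk T = mk T' :=
  Quotient.sound ⟨f, h⟩

noncomputable instance : Zero (EndoClass K) := ⟨Quotient.mk _ (null K)⟩

instance : One (EndoClass K) := ⟨Quotient.mk _ (unit K)⟩

instance : Add (EndoClass K) := ⟨Quotient.map₂ sum fun _ _ h _ _ h' => sum_congr h h'⟩

noncomputable instance : Mul (EndoClass K) :=
  ⟨Quotient.map₂ tensor fun _ _ h _ _ h' => tensor_congr h h'⟩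

protected theorem add_comm (a b : EndoClass K) : a + b = b + a := by
  obtain ⟨M⟩ := a
  obtain ⟨N⟩ := b
  exact Quotient.sound ⟨LinearEquiv.prodComm K _ _, fun _ => rfl⟩

protected theorem zero_add (a : EndoClass K) : 0 + a = a := by
  obtain ⟨M⟩ := a
  exact Quotient.sound (null_sum M)

protected theorem mul_comm (a b : EndoClass K) : a * b = b * a := by
  obtain ⟨M⟩ := a
  obtain ⟨N⟩ := b
  exact Quotient.sound (tensor_comm M N)

protected theorem one_mul (a : EndoClass K) : 1 * a = a := by
  obtain ⟨M⟩ := a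
  exact Quotient.sound (unit_tensor M)

protected theorem zero_mul (a : EndoClass K) : 0 * a = 0 := by
  obtain ⟨M⟩ := a
  exact Quotient.sound (iso_of_subsingleton _ _)

protected theorem mul_add (a b c : EndoClass K) : a * (b + c) = a * b + a * c := by
  obtain ⟨M⟩ := a
  obtain ⟨N⟩ := b
  obtain ⟨P⟩ := c
  exact Quotient.sound (tensor_sum M N P)

noncomputable instance : CommSemiring (EndoClass K) where
  add_assoc := by
    rintro ⟨M⟩ ⟨N⟩ ⟨P⟩
    exact Quotient.sound ⟨LinearEquiv.prodAssoc K _ _ _, fun _ => rfl⟩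
  zero_add := EndoClass.zero_add
  add_zero a := by rw [EndoClass.add_comm, EndoClass.zero_add]
  add_comm := EndoClass.add_comm
  nsmul := nsmulRec
  mul_assoc := by
    rintro ⟨M⟩ ⟨N⟩ ⟨P⟩
    exact Quotient.sound (tensor_assoc M N P)
  mul_comm := EndoClass.mul_comm
  one_mul := EndoClass.one_mul
  mul_one a := by rw [EndoClass.mul_comm, EndoClass.one_mul]
  zero_mul := EndoClass.zero_mul
  mul_zero a := by rw [EndoClass.mul_comm, EndoClass.zero_mul]
  left_distrib := EndoClass.mul_add
  right_distrib a b c := by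
    rw [EndoClass.mul_comm, EndoClass.mul_add, EndoClass.mul_comm c, EndoClass.mul_comm c]

section

variable {V W : Type u} [AddCommGroup V] [Module K V] [FiniteDimensional K V]
    [AddCommGroup W] [Module K W] [FiniteDimensional K W] (S : Module.End K V)
    (T : Module.End K W)

theorem mk_add_mk : mk S + mk T = mk (S.prodMap T) := rfl

theorem mk_mul_mk : mk S * mk T = mk (tensorEndo S T) := rfl

theorem mk_eq_zero [Subsingleton V] : mk S = 0 :=
  Quotient.sound (iso_of_subsingleton { carrier := V, endo := S } _)

theorem one_eq : (1 : EndoClass K) = mk (0 : Module.End K K) := rfl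

end

theorem mk_pi {ι : Type} [Fintype ι] (V : ι → Type u) [∀ i, AddCommGroup (V i)]
    [∀ i, Module K (V i)] [∀ i, FiniteDimensional K (V i)] (T : ∀ i, Module.End K (V i)) :
    mk (LinearMap.pi fun i => T i ∘ₗ LinearMap.proj i) = ∑ i, mk (T i) := by
  suffices ∀ (n : ℕ) (V : Fin n → Type u) [∀ i, AddCommGroup (V i)]
      [∀ i, Module K (V i)] [∀ i, FiniteDimensional K (V i)] (T : ∀ i, Module.End K (V i)),
      mk (LinearMap.pi fun i => T i ∘ₗ LinearMap.proj i) = ∑ i, mk (T i) by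
    let e := (Fintype.equivFin ι).symm
    rw [← e.sum_comp, ← this _ (fun i => V (e i))]
    symm
    exact mk_eq_mk (LinearEquiv.piCongrLeft K V e) fun x => by
      ext i
      obtain ⟨j, rfl⟩ := e.surjective i
      have h (y : ∀ i, V (e i)) : LinearEquiv.piCongrLeft K V e y (e j) = y j :=
        Equiv.piCongrLeft_apply_apply V e y j
      simp [h]
  intro n
  induction n with
  | zero => intros; rw [Fin.sum_univ_zero]; exact mk_eq_zero _
  | succ n ih =>
    intro V _ _ _ T
    rw [Fin.sum_univ_succ, ← ih (fun i => V i.succ), mk_add_mk]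
    symm
    let e : (V 0 × ∀ i : Fin n, V i.succ) ≃ₗ[K] ∀ i, V i :=
      { Fin.consEquiv V with
        map_add' := fun x y => by
          ext i; refine Fin.cases ?_ (fun j => ?_) i <;> simp [Fin.consEquiv]
        map_smul' := fun c y => by
          ext i; refine Fin.cases ?_ (fun j => ?_) i <;> simp [Fin.consEquiv] }
    refine mk_eq_mk e fun x => ?_
    ext i
    refine Fin.cases ?_ (fun j => ?_) i <;> simp [e, Fin.consEquiv]

end EndoClass

/-! ### Nilpotent Jordan blocks as truncated polynomial algebras -/

section Jordan

variable (K : Type u) [Field K]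

/-- The algebra `K[x] / (x ^ k)`. -/
abbrev TruncPoly (k : ℕ) : Type u := Polynomial K ⧸ Ideal.span {(Polynomial.X : Polynomial K) ^ k}

namespace TruncPoly

/-- The class of the variable. -/
noncomputable def x (k : ℕ) : TruncPoly K k := Ideal.Quotient.mk _ Polynomial.X

variable {K}

theorem x_pow_self (k : ℕ) : x K k ^ k = 0 := by
  rw [x, ← map_pow]
  exact Ideal.Quotient.eq_zero_iff_mem.2 (Ideal.mem_span_singleton_self _)

theorem x_pow_ne_zero {k j : ℕ} (h : j < k) : x K k ^ j ≠ 0 := by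
  rw [x, ← map_pow, Ne, Ideal.Quotient.eq_zero_iff_mem, Ideal.mem_span_singleton,
    pow_dvd_pow_iff Polynomial.X_ne_zero Polynomial.not_isUnit_X]
  exact h.not_ge

instance (k : ℕ) : FiniteDimensional K (TruncPoly K k) :=
  (AdjoinRoot.powerBasis (pow_ne_zero k (Polynomial.X_ne_zero (R := K)))).finite

theorem finrank_eq (k : ℕ) : Module.finrank K (TruncPoly K k) = k := by
  rw [finrank_quotient_span_eq_natDegree, Polynomial.natDegree_X_pow]

theorem eq_top_of_mem {k : ℕ} (W : Submodule K (TruncPoly K k)) (h : ∀ j, x K k ^ j ∈ W) :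
    W = ⊤ := by
  refine eq_top_iff.2 fun z _ => ?_
  obtain ⟨f, rfl⟩ := Ideal.Quotient.mk_surjective z
  induction f using Polynomial.induction_on' with
  | add f g hf hg => rw [map_add]; exact W.add_mem (hf trivial) (hg trivial)
  | monomial j c =>
    rw [← Polynomial.smul_X_eq_monomial]
    have : (Ideal.Quotient.mk (Ideal.span {(Polynomial.X : Polynomial K) ^ k}))
      (c • Polynomial.X ^ j) = c • x K k ^ j := by
      rw [x, ← map_pow]; rfl
    rw [this]
    exact W.smul_mem _ (h j)

/-- A vector killed by `T ^ k` receives a map from `K[x] / (x ^ k)`. -/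
theorem exists_lift {V : Type*} [AddCommGroup V] [Module K V] (T : Module.End K V) {k : ℕ} {v : V}
    (hv : (T ^ k) v = 0) :
    ∃ g : TruncPoly K k →ₗ[K] V, g 1 = v ∧ ∀ z, g (x K k * z) = T (g z) := by
  let f : Polynomial K →ₗ[K] V := LinearMap.applyₗ v ∘ₗ (Polynomial.aeval T).toLinearMap
  have hf : (Ideal.span {(Polynomial.X : Polynomial K) ^ k}).restrictScalars K ≤ LinearMap.ker f := by
    intro p hp
    obtain ⟨r, rfl⟩ := Ideal.mem_span_singleton'.1 hp
    simp [f, hv]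
  refine ⟨(Submodule.liftQ _ f hf) ∘ₗ
    (Submodule.Quotient.restrictScalarsEquiv K _).symm.toLinearMap, ?_, fun z => ?_⟩
  · have : f 1 = v := by simp [f]
    exact this
  · obtain ⟨z, rfl⟩ := Ideal.Quotient.mk_surjective z
    have : f (Polynomial.X * z) = T (f z) := by simp [f]
    exact this

end TruncPoly

end Jordan

namespace EndoClass

variable {K : Type u} [Field K]

/-- The class of a Jordan block of size `k` with eigenvalue zero. -/
noncomputable def jordan (K : Type u) [Field K] (k : ℕ) : EndoClass K :=
  mk (LinearMap.mulLeft K (TruncPoly.x K k))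

/-- A generation and dimension criterion for a decomposition into Jordan blocks. -/
theorem mk_eq_sum_jordan {V : Type u} [AddCommGroup V] [Module K V] [FiniteDimensional K V]
    (T : Module.End K V) {ι : Type} [Fintype ι] (v : ι → V) (k : ι → ℕ)
    (hv : ∀ i, (T ^ k i) (v i) = 0)
    (hgen : ∀ W : Submodule K V, (∀ w ∈ W, T w ∈ W) → (∀ i, v i ∈ W) → W = ⊤)
    (hdim : Module.finrank K V = ∑ i, k i) : mk T = ∑ i, jordan K (k i) := by
  classical
  choose g hg1 hgx using fun i => TruncPoly.exists_lift T (hv i)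
  let φ : (∀ i, TruncPoly K (k i)) →ₗ[K] V := LinearMap.lsum K _ K g
  have hφ (y : ∀ i, TruncPoly K (k i)) : φ (fun i => TruncPoly.x K (k i) * y i) = T (φ y) := by
    simp [φ, hgx]
  have hsurj : Function.Surjective φ := by
    rw [← LinearMap.range_eq_top]
    refine hgen _ ?_ fun i => ?_
    · rintro _ ⟨y, rfl⟩
      exact ⟨_, hφ y⟩
    · refine ⟨Pi.single i 1, ?_⟩
      simp only [φ, LinearMap.lsum_apply, LinearMap.sum_apply, LinearMap.comp_apply,
        LinearMap.proj_apply]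
      rw [Finset.sum_eq_single i]
      · simp [hg1]
      · intro j _ hj
        simp [Pi.single_eq_of_ne hj]
      · simp
  have hrank : Module.finrank K (∀ i, TruncPoly K (k i)) = Module.finrank K V := by
    rw [Module.finrank_pi_fintype, hdim]
    simp [TruncPoly.finrank_eq]
  have hinj := (LinearMap.injective_iff_surjective_of_finrank_eq_finrank hrank).2 hsurj
  unfold jordan
  rw [← mk_pi]
  symm
  exact mk_eq_mk (LinearEquiv.ofBijective φ ⟨hinj, hsurj⟩) hφ

end EndoClass

/-! ### Counting maximal Jordan blocks by ranks of powers -/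

theorem LinearMap.finrank_range_prodMap {K V W V' W' : Type*} [Field K] [AddCommGroup V] [Module K V]
    [AddCommGroup W] [Module K W] [AddCommGroup V'] [Module K V'] [AddCommGroup W'] [Module K W']
    [FiniteDimensional K V'] [FiniteDimensional K W'] (f : V →ₗ[K] V') (g : W →ₗ[K] W') :
    Module.finrank K (LinearMap.range (f.prodMap g)) =
      Module.finrank K (LinearMap.range f) + Module.finrank K (LinearMap.range g) := by
  let h := (LinearMap.range f).subtype.prodMap (LinearMap.range g).subtype
  have hh : Function.Injective h :=
    Function.Injective.prodMap (Submodule.injective_subtype _) (Submodule.injective_subtype _)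
  rw [← Module.finrank_prod, ← LinearMap.finrank_range_of_inj hh]
  rw [LinearMap.range_prodMap, LinearMap.range_prodMap, Submodule.range_subtype,
    Submodule.range_subtype]

namespace EndoClass

variable {K : Type u} [Field K]

/-- The rank of the `j`-th power of the endomorphism. -/
noncomputable def rankPow (j : ℕ) : EndoClass K →+ ℤ where
  toFun := Quotient.lift
    (fun M : EndoSpace K => (Module.finrank K (LinearMap.range (M.endo ^ j)) : ℤ)) (by
      rintro M N ⟨f, hf⟩
      have hfj (x : M.carrier) : f ((M.endo ^ j) x) = (N.endo ^ j) (f x) := by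
        induction j generalizing x with
        | zero => rfl
        | succ j ih => rw [pow_succ, pow_succ, Module.End.mul_apply, Module.End.mul_apply, ih, hf]
      have : LinearMap.range (N.endo ^ j) = (LinearMap.range (M.endo ^ j)).map f.toLinearMap := by
        ext y
        constructor
        · rintro ⟨x, rfl⟩
          exact ⟨_, ⟨f.symm x, rfl⟩, by simp [hfj]⟩
        · rintro ⟨_, ⟨x, rfl⟩, rfl⟩
          exact ⟨f x, (hfj x).symm⟩
      change (_ : ℤ) = _
      rw [this, LinearEquiv.finrank_map_eq])
  map_zero' := by
    change ((Module.finrank K _ : ℕ) : ℤ) = 0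
    have : Subsingleton (EndoSpace.null K).carrier := inferInstance
    rw [Nat.cast_eq_zero]
    exact Module.finrank_zero_of_subsingleton
  map_add' := by
    rintro ⟨M⟩ ⟨N⟩
    have : (M.endo.prodMap N.endo) ^ j = (M.endo ^ j).prodMap (N.endo ^ j) := by
      induction j with
      | zero => rfl
      | succ j ih => rw [pow_succ, ih, LinearMap.prodMap_mul, pow_succ, pow_succ]
    change ((Module.finrank K (LinearMap.range ((M.endo.prodMap N.endo) ^ j)) : ℕ) : ℤ) =
      ((Module.finrank K (LinearMap.range (M.endo ^ j)) : ℕ) : ℤ) +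
      ((Module.finrank K (LinearMap.range (N.endo ^ j)) : ℕ) : ℤ)
    rw [this, LinearMap.finrank_range_prodMap]
    push_cast
    rfl

theorem rankPow_mk {V : Type u} [AddCommGroup V] [Module K V] [FiniteDimensional K V]
    (T : Module.End K V) (j : ℕ) :
    rankPow j (mk T) = Module.finrank K (LinearMap.range (T ^ j)) := rfl

/-- On a block of size k ≤ Q the power x^{Q-1} vanishes unless k = Q, where its image is the socle
line. So on sums of blocks of size at most Q, this rank counts the blocks of size exactly Q. -/
theorem rankPow_jordan {Q k : ℕ} (hk : k ≤ Q) (hQ : 0 < Q) :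
    rankPow (Q - 1) (jordan K k) = if k = Q then 1 else 0 := by
  rw [jordan, rankPow_mk, LinearMap.pow_mulLeft]
  split_ifs with h
  · subst h
    have hx := TruncPoly.x_pow_ne_zero (K := K) (k := k) (j := k - 1) (by omega)
    have : LinearMap.range (LinearMap.mulLeft K (TruncPoly.x K k ^ (k - 1))) =
        Submodule.span K {TruncPoly.x K k ^ (k - 1)} := by
      apply le_antisymm
      · have : Submodule.comap (LinearMap.mulLeft K (TruncPoly.x K k ^ (k - 1)))
          (Submodule.span K {TruncPoly.x K k ^ (k - 1)}) = ⊤ := by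
          refine TruncPoly.eq_top_of_mem _ fun j => ?_
          rw [Submodule.mem_comap, LinearMap.mulLeft_apply, ← pow_add]
          rcases Nat.eq_zero_or_pos j with rfl | hj
          · exact Submodule.mem_span_singleton_self _
          · have : k - 1 + j = k + (j - 1) := by omega
            rw [this, pow_add, TruncPoly.x_pow_self, zero_mul]
            exact Submodule.zero_mem _
        rintro _ ⟨z, rfl⟩
        have hz : z ∈ (⊤ : Submodule K (TruncPoly K k)) := trivial
        rw [← this] at hz
        exact hz
      · rw [Submodule.span_singleton_le_iff_mem]
        exact ⟨1, by simp⟩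
    rw [this, finrank_span_singleton hx]
    rfl
  · have : Q - 1 = k + (Q - 1 - k) := by omega
    rw [this, pow_add, TruncPoly.x_pow_self, zero_mul]
    simp

end EndoClass

/-! ### The Grothendieck ring -/

/-- The Grothendieck ring of finite-dimensional vector spaces with an endomorphism. -/
abbrev EndoRing (K : Type u) [Field K] : Type (u + 1) := ℤ ⊗[ℕ] EndoClass K

namespace EndoRing

variable {K : Type u} [Field K]

/-- The canonical map from isomorphism classes. -/
noncomputable def of : EndoClass K →+* EndoRing K :=
  (Algebra.TensorProduct.includeRight : EndoClass K →ₐ[ℕ] EndoRing K).toRingHom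

/-- The additive extension of `EndoClass.rankPow`. -/
noncomputable def rankPow (j : ℕ) : EndoRing K →+ ℤ :=
  (TensorProduct.lift (LinearMap.mk₂ ℕ (fun (a : ℤ) (M : EndoClass K) => a * EndoClass.rankPow j M)
    (fun a b M => by ring) (fun n a M => by simp [mul_assoc]) (fun a M N => by simp [mul_add])
    (fun n a M => by rw [map_nsmul, mul_smul_comm]))).toAddMonoidHom

theorem rankPow_of (j : ℕ) (M : EndoClass K) : rankPow j (of M) = EndoClass.rankPow j M := by
  change (1 : ℤ) * EndoClass.rankPow j M = _
  exact one_mul _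

/-- The class of a Jordan block of size `k` with eigenvalue zero. -/
noncomputable def δ (K : Type u) [Field K] (k : ℕ) : EndoRing K := of (EndoClass.jordan K k)

theorem rankPow_δ {Q k : ℕ} (hk : k ≤ Q) (hQ : 0 < Q) :
    rankPow (Q - 1) (δ K k) = if k = Q then 1 else 0 := by
  rw [δ, rankPow_of, EndoClass.rankPow_jordan hk hQ]

end EndoRing

/-! ### Products of Jordan blocks in characteristic p -/

section SquareZero

variable {A : Type*} [CommRing A]

theorem add_pow_succ_of_sq_zero {x y : A} (hx : x * x = 0) (m : ℕ) :
    (x + y) ^ (m + 1) = y ^ (m + 1) + (m + 1) * x * y ^ m := by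
  induction m with
  | zero => simp [add_comm]
  | succ m ih =>
    rw [pow_succ, ih]
    push_cast
    linear_combination (m + 1) * y ^ m * hx

theorem pow_mul_eq_of_mul_eq {u s c : A} (h : u * c = s * c) (n : ℕ) :
    u ^ n * c = s ^ n * c := by
  induction n with
  | zero => simp
  | succ n ih => linear_combination u ^ n * h + s * ih

end SquareZero

namespace EndoClass

variable {K : Type u} [Field K]

theorem jordan_zero : jordan K 0 = 0 := by
  have : Subsingleton (TruncPoly K 0) := Module.finrank_zero_iff.1 (TruncPoly.finrank_eq 0)
  exact mk_eq_zero _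

theorem jordan_one : jordan K 1 = 1 := by
  rw [one_eq, mk_eq_sum_jordan (ι := Unit) (0 : Module.End K K) (fun _ => 1) (fun _ => 1)]
  · simp
  · simp
  · intro W _ h
    exact eq_top_iff.2 fun c _ => by simpa using W.smul_mem c (h ())
  · simp

theorem jordan_mul_jordan_eq_mk (a b : ℕ) : jordan K a * jordan K b = mk (LinearMap.mulLeft K
    (TruncPoly.x K a ⊗ₜ[K] (1 : TruncPoly K b) + (1 : TruncPoly K a) ⊗ₜ[K] TruncPoly.x K b)) := by
  rw [jordan, jordan, mk_mul_mk]
  congr 1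
  refine TensorProduct.ext' fun y z => ?_
  simp [add_mul]

/-- Hides the tensor product behind an abstract algebra spanned by monomials in S and T, so that
later arguments are plain commutative algebra. -/
theorem exists_jordan_mul_jordan_model (K : Type u) [Field K] (a b : ℕ) :
    ∃ (A : Type u) (_ : CommRing A) (_ : Algebra K A) (_ : FiniteDimensional K A) (S T : A),
      Module.finrank K A = a * b ∧ S ^ a = 0 ∧ T ^ b = 0 ∧
      jordan K a * jordan K b = mk (LinearMap.mulLeft K (S + T)) ∧
      ∀ W : Submodule K A, (∀ i j, S ^ i * T ^ j ∈ W) → W = ⊤ := by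
  refine ⟨TruncPoly K a ⊗[K] TruncPoly K b, inferInstance, inferInstance, inferInstance,
    TruncPoly.x K a ⊗ₜ[K] 1, 1 ⊗ₜ[K] TruncPoly.x K b, ?_, ?_, ?_, jordan_mul_jordan_eq_mk a b,
    fun W hST => ?_⟩
  · rw [Module.finrank_tensorProduct, TruncPoly.finrank_eq, TruncPoly.finrank_eq]
  · rw [Algebra.TensorProduct.tmul_pow, TruncPoly.x_pow_self, TensorProduct.zero_tmul]
  · rw [Algebra.TensorProduct.tmul_pow, TruncPoly.x_pow_self, TensorProduct.tmul_zero]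
  refine eq_top_iff.2 fun z _ => ?_
  induction z with
  | zero => exact W.zero_mem
  | add y z hy hz => exact W.add_mem (hy trivial) (hz trivial)
  | tmul y z =>
    let f := TensorProduct.mk K (TruncPoly K a) (TruncPoly K b)
    have h1 (j : ℕ) (y : TruncPoly K a) : y ⊗ₜ[K] (TruncPoly.x K b ^ j) ∈ W := by
      have : W.comap (f.flip (TruncPoly.x K b ^ j)) = ⊤ :=
        TruncPoly.eq_top_of_mem _ fun i => by simpa [f] using hST i j
      have hy : y ∈ W.comap (f.flip (TruncPoly.x K b ^ j)) := this ▸ Submodule.mem_top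
      exact hy
    have : W.comap (f y) = ⊤ := TruncPoly.eq_top_of_mem _ fun j => h1 j y
    have hz : z ∈ W.comap (f y) := this ▸ Submodule.mem_top
    exact hz

/-- A product of two Jordan blocks is computed in `K[S, T] / (S ^ a, T ^ b)`. -/
theorem jordan_mul_jordan (p : ℕ) [CharP K p] {a b : ℕ} (ha : 0 < a) (hb : 0 < b)
    {ι : Type} [Fintype ι] (k : ι → ℕ) (hdim : a * b = ∑ i, k i)
    (h : ∀ (A : Type u) [CommRing A] [Algebra K A] [CharP A p] (S T : A), S ^ a = 0 → T ^ b = 0 →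
      ∃ v : ι → A, (∀ i, (S + T) ^ k i * v i = 0) ∧
        ∀ W : Submodule K A, (∀ w ∈ W, (S + T) * w ∈ W) → (∀ i, v i ∈ W) → ∀ i < a, S ^ i ∈ W) :
    jordan K a * jordan K b = ∑ i, jordan K (k i) := by
  obtain ⟨A, _, _, _, S, T, hfin, hSa, hTb, hmk, htop⟩ := exists_jordan_mul_jordan_model K a b
  have : Nontrivial A := Module.nontrivial_of_finrank_pos (R := K) (by rw [hfin]; positivity)
  have : CharP A p := charP_of_injective_algebraMap (algebraMap K A).injective p
  obtain ⟨v, hv, hgen⟩ := h A S T hSa hTb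
  rw [hmk]
  refine mk_eq_sum_jordan _ v k (fun i => ?_) (fun W hW hvW => ?_) (hfin.trans hdim)
  · rw [LinearMap.pow_mulLeft]
    exact hv i
  · have hSi (i : ℕ) : S ^ i ∈ W := by
      rcases lt_or_ge i a with hi | hi
      · exact hgen W hW hvW i hi
      · rw [pow_eq_zero_of_le hi hSa]
        exact W.zero_mem
    have hST (j i : ℕ) : S ^ i * T ^ j ∈ W := by
      induction j generalizing i with
      | zero => simpa using hSi i
      | succ j ih =>
        have : S ^ i * T ^ (j + 1) = (S + T) * (S ^ i * T ^ j) - S ^ (i + 1) * T ^ j := by ring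
        rw [this]
        exact W.sub_mem (hW _ (ih i)) (ih (i + 1))
    exact htop W fun i j => hST j i

end EndoClass

namespace EndoRing

variable {K : Type u} [Field K]

@[simp]
theorem δ_zero : (δ K 0) = 0 := by rw [δ, EndoClass.jordan_zero, map_zero]

@[simp]
theorem δ_one : (δ K 1) = 1 := by rw [δ, EndoClass.jordan_one, map_one]

theorem δ_mul_δ (p : ℕ) [CharP K p] {a b : ℕ} (ha : 0 < a) (hb : 0 < b)
    {ι : Type} [Fintype ι] (k : ι → ℕ) (hdim : a * b = ∑ i, k i)
    (h : ∀ (A : Type u) [CommRing A] [Algebra K A] [CharP A p] (S T : A), S ^ a = 0 → T ^ b = 0 →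
      ∃ v : ι → A, (∀ i, (S + T) ^ k i * v i = 0) ∧
        ∀ W : Submodule K A, (∀ w ∈ W, (S + T) * w ∈ W) → (∀ i, v i ∈ W) → ∀ i < a, S ^ i ∈ W) :
    (δ K a * δ K b) = ∑ i, δ K (k i) := by
  simp only [δ]
  rw [← map_mul, EndoClass.jordan_mul_jordan p ha hb k hdim h, map_sum]

variable (p : ℕ) [Fact p.Prime] [CharP K p]

/-- With q = p^e, Frobenius and S^q = 0 give (S + T)^q = T^q, so each of the a vectors S^i is killed
by (S + T)^{qu}. -/
theorem δ_mul_δ_mul {a e : ℕ} (ha : a ≤ p ^ e) (u : ℕ) :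
    (δ K a * δ K (p ^ e * u)) = (a : EndoRing K) * δ K (p ^ e * u) := by
  rcases Nat.eq_zero_or_pos a with rfl | ha0
  · simp
  rcases Nat.eq_zero_or_pos u with rfl | hu
  · simp
  have hp : 0 < p ^ e := pow_pos (Fact.out (p := p.Prime)).pos e
  rw [δ_mul_δ p ha0 (by positivity) (ι := Fin a) (fun _ => p ^ e * u) (by simp)]
  · simp
  · intro A _ _ _ S T hS hT
    refine ⟨fun i => S ^ (i : ℕ), fun i => ?_, fun W _ h i hi => h ⟨i, hi⟩⟩
    rw [pow_mul, add_pow_char_pow, pow_eq_zero_of_le ha hS, zero_add, ← pow_mul, hT, zero_mul]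

/-- Here (S + T)^{qu} = T^{qu} is killed by T, so S + T acts on it as S. The vector 1 therefore
gives the long block, and the vectors S^i T give the short ones. -/
theorem δ_succ_mul_δ {a e : ℕ} (ha : a + 1 ≤ p ^ e) (u : ℕ) :
    (δ K (a + 1) * δ K (p ^ e * u + 1)) =
      δ K (p ^ e * u + (a + 1)) + (a : EndoRing K) * δ K (p ^ e * u) := by
  rw [δ_mul_δ p (Nat.succ_pos a) (Nat.succ_pos _) (ι := Option (Fin a))
    (fun o => o.elim (p ^ e * u + (a + 1)) fun _ => p ^ e * u)]
  · simp
  · simp; ring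
  · intro A _ _ _ S T hS hT
    have hU : (S + T) ^ (p ^ e * u) = T ^ (p ^ e * u) := by
      rw [pow_mul, add_pow_char_pow, pow_eq_zero_of_le ha hS, zero_add, ← pow_mul]
    have hT' : T ^ (p ^ e * u) * T = 0 := by rw [← pow_succ, hT]
    refine ⟨fun o => o.elim 1 fun i => S ^ (i : ℕ) * T, ?_, fun W hW h i hi => ?_⟩
    · rintro (_ | i)
      · have : (S + T) ^ (a + 1) * T ^ (p ^ e * u) = S ^ (a + 1) * T ^ (p ^ e * u) :=
          pow_mul_eq_of_mul_eq (by linear_combination hT') _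
        simp only [Option.elim]
        rw [pow_add, hU, mul_one, mul_comm, this, hS, zero_mul]
      · simp only [Option.elim]
        rw [hU]
        linear_combination S ^ (i : ℕ) * hT'
    · induction i with
      | zero => simpa using h none
      | succ i ih =>
        have h2 : S ^ (i + 1) = (S + T) * S ^ i - S ^ i * T := by ring
        rw [h2]
        exact W.sub_mem (hW _ (ih (by omega))) (h (some ⟨i, by omega⟩))

/-- Now S^{q+1} = 0, so X = S^q has square zero and with Y = T^q one gets (S + T)^{q(k+1)} = Y^{k+1}
+ (k+1) X Y^k. Invertibility of m + 1 is what recovers S^q from the generators. -/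
theorem δ_succ_mul_δ_mul {r e m : ℕ} (hr : p ^ e = r + 1) (hm : (m + 1 : K) ≠ 0) :
    δ K (p ^ e + 1) * δ K (p ^ e * (m + 1)) =
      (r : EndoRing K) * δ K (p ^ e * (m + 1)) + δ K (p ^ e * m) + δ K (p ^ e * (m + 2)) := by
  rw [δ_mul_δ p (Nat.succ_pos _) (by rw [hr]; positivity) (ι := Fin r ⊕ Fin 2)
    (Sum.elim (fun _ => p ^ e * (m + 1)) ![p ^ e * m, p ^ e * (m + 2)])]
  · simp [add_assoc]
  · simp [hr]; ring
  · intro A _ _ _ S T hS hT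
    have hq := add_pow_char_pow S T p e
    rw [hr] at hS hT hq ⊢
    have hXS : S ^ (r + 1) * S = 0 := by rw [← pow_succ, hS]
    have hXX : S ^ (r + 1) * S ^ (r + 1) = 0 := by linear_combination S ^ r * hXS
    have hY : (T ^ (r + 1)) ^ (m + 1) = 0 := by rw [← pow_mul, hT]
    have hU (n : ℕ) : (S + T) ^ ((r + 1) * (n + 1)) = (T ^ (r + 1)) ^ (n + 1) +
        (n + 1) * S ^ (r + 1) * (T ^ (r + 1)) ^ n := by
      rw [pow_mul, hq, add_pow_succ_of_sq_zero hXX]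
    have hUX : (S + T) ^ ((r + 1) * m) * S ^ (r + 1) = (T ^ (r + 1)) ^ m * S ^ (r + 1) := by
      rw [pow_mul, hq]
      exact pow_mul_eq_of_mul_eq (by linear_combination hXX) _
    -- The combination (m+1) S^q - (S+T)^q is chosen so that multiplying by (S+T)^{qm} cancels the
    -- two terms X Y^m and leaves -Y^{m+1} = 0.
    refine ⟨Sum.elim (fun i => S ^ ((i : ℕ) + 1)) ![(m + 1) * S ^ (r + 1) - (S + T) ^ (r + 1), 1],
      ?_, fun W hW h i hi => ?_⟩
    · rintro (i | i)
      · simp only [Sum.elim_inl]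
        rw [hU]
        linear_combination S ^ ((i : ℕ) + 1) * hY + (m + 1) * (T ^ (r + 1)) ^ m * S ^ (i : ℕ) * hXS
      · fin_cases i
        · simp only [Sum.elim_inr, Fin.zero_eta, Matrix.cons_val_zero]
          have h3 : (S + T) ^ ((r + 1) * m) * ((m + 1) * S ^ (r + 1) - (S + T) ^ (r + 1)) =
              (m + 1) * ((S + T) ^ ((r + 1) * m) * S ^ (r + 1)) -
                (S + T) ^ ((r + 1) * (m + 1)) := by ring
          rw [h3, hUX, hU]
          linear_combination -hY
        · simp only [Sum.elim_inr, Fin.mk_one, Matrix.cons_val_one, Matrix.cons_val_zero]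
          rw [show m + 2 = m + 1 + 1 by ring, hU]
          push_cast
          linear_combination (T ^ (r + 1) + (m + 2) * S ^ (r + 1)) * hY
    · have h1 : (1 : A) ∈ W := h (Sum.inr 1)
      have hUn (n : ℕ) : (S + T) ^ n ∈ W := by
        induction n with
        | zero => simpa using h1
        | succ n ih => rw [pow_succ']; exact hW _ ih
      rcases i with _ | i
      · simpa using h1
      rcases Nat.lt_succ_iff_lt_or_eq.1 (Nat.succ_lt_succ_iff.1 hi) with h2 | rfl
      · exact h (Sum.inl ⟨i, h2⟩)
      · rw [← W.smul_mem_iff hm]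
        have : (m + 1 : K) • S ^ (i + 1) =
            ((m + 1) * S ^ (i + 1) - (S + T) ^ (i + 1)) + (S + T) ^ (i + 1) := by
          rw [Algebra.smul_def]
          simp
        rw [this]
        exact W.add_mem (h (Sum.inr 0)) (hUn _)

section

variable {A : Type u} [CommRing A] [Algebra K A] [CharP A p] {S T : A} {m : ℕ}

/-- Generation part of the fusion rule. -/
theorem pow_mem_of_fusion_generators (r : ℕ) (hm : (m + 1 : K) ≠ 0)
    (W : Submodule K A) (hW : ∀ w ∈ W, (S + T) * w ∈ W) (h0 : 1 ∈ W) (hS : S ∈ W)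
    (hST : ∀ i : Fin r, S ^ ((i : ℕ) + 1) * T ∈ W)
    (hv : (m + 1) * S ^ (r + 2) - (S + T) ^ (r + 1) * T ∈ W) (i : ℕ) (hi : i < r + 3) :
    S ^ i ∈ W := by
  have hT : T ∈ W := by
    have : T = (S + T) * 1 - S := by ring
    rw [this]
    exact W.sub_mem (hW 1 h0) hS
  have hUT (n : ℕ) : (S + T) ^ n * T ∈ W := by
    induction n with
    | zero => simpa using hT
    | succ n ih => rw [pow_succ', mul_assoc]; exact hW _ ih
  rcases Nat.lt_succ_iff_lt_or_eq.1 hi with h | rfl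
  · clear hi
    induction i with
    | zero => simpa using h0
    | succ i ih =>
      rcases Nat.eq_zero_or_pos i with rfl | hi0
      · simpa using hS
      have h2 : S ^ (i + 1) = (S + T) * S ^ i - S ^ i * T := by ring
      rw [h2]
      refine W.sub_mem (hW _ (ih (by omega))) ?_
      have := hST ⟨i - 1, by omega⟩
      rwa [show i - 1 + 1 = i by omega] at this
  · rw [← W.smul_mem_iff hm]
    have : (m + 1 : K) • S ^ (r + 2) =
        ((m + 1) * S ^ (r + 2) - (S + T) ^ (r + 1) * T) + (S + T) ^ (r + 1) * T := by
      rw [Algebra.smul_def]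
      simp
    rw [this]
    exact W.add_mem hv (hUT _)

end

/-- The same expansion in X = S^q and Y = T^q applies, now with Y^{m+1} T = 0. The three special
generators are corrections of S^q, S and 1; invertibility of m + 2 separates S from S + T. -/
theorem δ_fusion {r e m : ℕ} (hr : p ^ e = r + 2) (hm : (m + 1 : K) ≠ 0) (hm' : (m + 2 : K) ≠ 0) :
    (δ K (p ^ e + 1) * δ K (p ^ e * (m + 1) + 1)) =
      (r : EndoRing K) * δ K (p ^ e * (m + 1)) + δ K (p ^ e * m + 1) + δ K (p ^ e * (m + 1) + (r + 1)) +
        δ K (p ^ e * (m + 2) + 1) := by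
  rw [δ_mul_δ p (Nat.succ_pos _) (Nat.succ_pos _) (ι := Fin r ⊕ Fin 3)
    (Sum.elim (fun _ => p ^ e * (m + 1))
      ![p ^ e * m + 1, p ^ e * (m + 1) + (r + 1), p ^ e * (m + 2) + 1])]
  · simp [Fin.sum_univ_three, add_assoc]
  · simp [Fin.sum_univ_three, hr]; ring
  · intro A _ _ _ S T hS hT
    have hq := add_pow_char_pow S T p e
    rw [hr] at hS hT hq ⊢
    have hXX : S ^ (r + 2) * S ^ (r + 2) = 0 := by
      rw [← pow_add]; exact pow_eq_zero_of_le (by omega) hS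
    have hXS : S ^ (r + 2) * S = 0 := by rw [← pow_succ, hS]
    have hYT : (T ^ (r + 2)) ^ (m + 1) * T = 0 := by rw [← pow_mul, ← pow_succ, hT]
    have hU (n : ℕ) : (S + T) ^ ((r + 2) * (n + 1)) = (T ^ (r + 2)) ^ (n + 1) +
        (n + 1) * S ^ (r + 2) * (T ^ (r + 2)) ^ n := by
      rw [pow_mul, hq, add_pow_succ_of_sq_zero hXX]
    have hUX : (S + T) ^ ((r + 2) * m) * S ^ (r + 2) = (T ^ (r + 2)) ^ m * S ^ (r + 2) := by
      rw [pow_mul, hq]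
      exact pow_mul_eq_of_mul_eq (by linear_combination hXX) _
    -- Since (S+T)^{q(m+1)} = Y^{m+1} + (m+1) X Y^m, the coefficients m + 1 make the leading terms
    -- cancel after exactly qm + 1 and q(m+1) + q - 1 applications of S + T.
    refine ⟨Sum.elim (fun i => S ^ ((i : ℕ) + 1) * T) ![(m + 1) * S ^ (r + 2) -
      (S + T) ^ (r + 1) * T, (m + 1) * S - T, 1], ?_, fun W hW h i hi => ?_⟩
    · rintro (i | i)
      · simp only [Sum.elim_inl]
        rw [hU]
        linear_combination S ^ ((i : ℕ) + 1) * hYT +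
          (m + 1) * (T ^ (r + 2)) ^ m * S ^ (i : ℕ) * T * hXS
      · fin_cases i
        · simp only [Sum.elim_inr, Fin.zero_eta, Matrix.cons_val_zero]
          have h3 : (S + T) ^ ((r + 2) * m + 1) * ((m + 1) * S ^ (r + 2) - (S + T) ^ (r + 1) * T) =
              (m + 1) * (S + T) * ((S + T) ^ ((r + 2) * m) * S ^ (r + 2)) -
                (S + T) ^ ((r + 2) * (m + 1)) * T := by ring
          rw [h3, hUX, hU]
          linear_combination (m + 1) * (T ^ (r + 2)) ^ m * hXS - hYT
        · simp only [Sum.elim_inr, Fin.mk_one, Matrix.cons_val_one, Matrix.cons_val_zero]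
          have h4 : (S + T) ^ (r + 1) * (S * (T ^ (r + 2)) ^ (m + 1)) =
              S ^ (r + 1) * (S * (T ^ (r + 2)) ^ (m + 1)) :=
            pow_mul_eq_of_mul_eq (by linear_combination S * hYT) _
          have h5 : (S + T) ^ (r + 1) * (S ^ (r + 2) * (T ^ (r + 2)) ^ m * T) =
              T ^ (r + 1) * (S ^ (r + 2) * (T ^ (r + 2)) ^ m * T) :=
            pow_mul_eq_of_mul_eq (by linear_combination (T ^ (r + 2)) ^ m * T * hXS) _
          rw [pow_add, hU]
          linear_combination (m + 1) * h4 - (m + 1) * h5 - (S + T) ^ (r + 1) * hYT +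
            (S + T) ^ (r + 1) * (m + 1) ^ 2 * (T ^ (r + 2)) ^ m * hXS
        · simp only [Sum.elim_inr, Fin.reduceFinMk, Matrix.cons_val]
          rw [pow_succ, show m + 2 = m + 1 + 1 by ring, hU]
          push_cast
          linear_combination (S + T) * T ^ (r + 1) * hYT +
            (m + 2) * (T ^ (r + 2)) ^ (m + 1) * hXS + (m + 2) * S ^ (r + 2) * hYT
    · have h1 : (1 : A) ∈ W := h (Sum.inr 2)
      have hU1 : S + T ∈ W := by simpa using hW 1 h1
      have h2 : (m + 1) * S - T ∈ W := h (Sum.inr 1)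
      have h3 : S ∈ W := by
        rw [← W.smul_mem_iff hm']
        have : (m + 2 : K) • S = (S + T) + ((m + 1) * S - T) := by
          rw [Algebra.smul_def]
          simp only [map_add, map_natCast, map_ofNat]
          ring
        rw [this]
        exact W.add_mem hU1 h2
      exact pow_mem_of_fusion_generators r hm W hW h1 h3 (fun i => h (Sum.inl i)) (h (Sum.inr 0))
        i hi

/-- When m + 2 = p, the generator (m+1) S - T of the generic case is -(S + T) and becomes redundant;
T replaces it. Also (S+T)^{qp} = 0 now, so the vectors T and 1 both give blocks of size qp. -/
theorem δ_fusion_last {r e m : ℕ} (hr : p ^ e = r + 2) (hm : (m + 1 : K) ≠ 0) (hm' : m + 2 = p) :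
    (δ K (p ^ e + 1) * δ K (p ^ e * (m + 1) + 1)) =
      (r : EndoRing K) * δ K (p ^ e * (m + 1)) + δ K (p ^ e * m + 1) + 2 * δ K (p ^ e * (m + 2)) := by
  rw [δ_mul_δ p (Nat.succ_pos _) (Nat.succ_pos _) (ι := Fin r ⊕ Fin 3)
    (Sum.elim (fun _ => p ^ e * (m + 1))
      ![p ^ e * m + 1, p ^ e * (m + 2), p ^ e * (m + 2)])]
  · simp [Fin.sum_univ_three, add_assoc, two_mul]
  · simp [Fin.sum_univ_three, hr]; ring
  · intro A _ _ _ S T hS hT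
    have hq := add_pow_char_pow S T p e
    rw [hr] at hS hT hq ⊢
    have hpA : (m + 2 : A) = 0 := by
      have := CharP.cast_eq_zero A p
      rw [← hm'] at this
      simpa using this
    have hXX : S ^ (r + 2) * S ^ (r + 2) = 0 := by
      rw [← pow_add]; exact pow_eq_zero_of_le (by omega) hS
    have hXS : S ^ (r + 2) * S = 0 := by rw [← pow_succ, hS]
    have hYT : (T ^ (r + 2)) ^ (m + 1) * T = 0 := by rw [← pow_mul, ← pow_succ, hT]
    have hU (n : ℕ) : (S + T) ^ ((r + 2) * (n + 1)) = (T ^ (r + 2)) ^ (n + 1) +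
        (n + 1) * S ^ (r + 2) * (T ^ (r + 2)) ^ n := by
      rw [pow_mul, hq, add_pow_succ_of_sq_zero hXX]
    have hUX : (S + T) ^ ((r + 2) * m) * S ^ (r + 2) = (T ^ (r + 2)) ^ m * S ^ (r + 2) := by
      rw [pow_mul, hq]
      exact pow_mul_eq_of_mul_eq (by linear_combination hXX) _
    have hUlast : (S + T) ^ ((r + 2) * (m + 2)) = 0 := by
      rw [show m + 2 = m + 1 + 1 by ring, hU]
      push_cast
      linear_combination T ^ (r + 1) * hYT + S ^ (r + 2) * (T ^ (r + 2)) ^ (m + 1) * hpA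
    refine ⟨Sum.elim (fun i => S ^ ((i : ℕ) + 1) * T) ![(m + 1) * S ^ (r + 2) -
      (S + T) ^ (r + 1) * T, T, 1], ?_, fun W hW h i hi => ?_⟩
    · rintro (i | i)
      · simp only [Sum.elim_inl]
        rw [hU]
        linear_combination S ^ ((i : ℕ) + 1) * hYT +
          (m + 1) * (T ^ (r + 2)) ^ m * S ^ (i : ℕ) * T * hXS
      · fin_cases i
        · simp only [Sum.elim_inr, Fin.zero_eta, Matrix.cons_val_zero]
          have h3 : (S + T) ^ ((r + 2) * m + 1) * ((m + 1) * S ^ (r + 2) - (S + T) ^ (r + 1) * T) =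
              (m + 1) * (S + T) * ((S + T) ^ ((r + 2) * m) * S ^ (r + 2)) -
                (S + T) ^ ((r + 2) * (m + 1)) * T := by ring
          rw [h3, hUX, hU]
          linear_combination (m + 1) * (T ^ (r + 2)) ^ m * hXS - hYT
        · simp only [Sum.elim_inr, Fin.mk_one, Matrix.cons_val_one, Matrix.cons_val_zero]
          rw [hUlast, zero_mul]
        · simp only [Sum.elim_inr, Fin.reduceFinMk, Matrix.cons_val]
          rw [hUlast, zero_mul]
    · have h1 : (1 : A) ∈ W := h (Sum.inr 2)
      have hU1 : S + T ∈ W := by simpa using hW 1 h1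
      have h2 : T ∈ W := h (Sum.inr 1)
      have h3 : S ∈ W := by simpa using W.sub_mem hU1 h2
      exact pow_mem_of_fusion_generators r hm W hW h1 h3 (fun i => h (Sum.inl i)) (h (Sum.inr 0))
        i hi

end EndoRing

/-! ### Multiplication rules in axiomatic form -/

/-- The multiplication rules of the classes of nilpotent Jordan blocks in characteristic `p`. -/
structure IsGreenSequence (p : ℕ) {G : Type*} [CommRing G] (δ : ℕ → G) : Prop where
  zero : δ 0 = 0
  one : δ 1 = 1
  mul_block : ∀ e a u, a ≤ p ^ e → δ a * δ (p ^ e * u) = a * δ (p ^ e * u)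
  succ_mul_succ : ∀ e a u, a + 1 ≤ p ^ e →
    δ (a + 1) * δ (p ^ e * u + 1) = δ (p ^ e * u + (a + 1)) + a * δ (p ^ e * u)
  succ_mul_block : ∀ e m, m + 1 < p → δ (p ^ e + 1) * δ (p ^ e * (m + 1)) =
    (p ^ e - 1) * δ (p ^ e * (m + 1)) + δ (p ^ e * m) + δ (p ^ e * (m + 2))
  fusion : ∀ e m, m + 2 < p → δ (p ^ e + 1) * δ (p ^ e * (m + 1) + 1) =
    (p ^ e - 2) * δ (p ^ e * (m + 1)) + δ (p ^ e * m + 1) + δ (p ^ e * (m + 1) + (p ^ e - 1)) +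
      δ (p ^ e * (m + 2) + 1)
  fusion_last : ∀ e m, m + 2 = p → δ (p ^ e + 1) * δ (p ^ e * (m + 1) + 1) =
    (p ^ e - 2) * δ (p ^ e * (m + 1)) + δ (p ^ e * m + 1) + 2 * δ (p ^ e * (m + 2))

namespace EndoRing

theorem natCast_succ_ne_zero {p : ℕ} {K : Type*} [Field K] [CharP K p] {m : ℕ} (hm : m + 1 < p) :
    (m + 1 : K) ≠ 0 := by
  have := (CharP.cast_eq_zero_iff K p (m + 1)).not.2 (Nat.not_dvd_of_pos_of_lt (Nat.succ_pos m) hm)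
  exact_mod_cast this

theorem exists_pow_eq_add_two {p e : ℕ} (hp : 2 < p) (he : 0 < e) : ∃ r, p ^ e = r + 2 :=
  Nat.exists_eq_add_of_le' (hp.le.trans (Nat.le_self_pow he.ne' p))

theorem isGreenSequence (p : ℕ) [Fact p.Prime] (hp : 2 < p) (K : Type u) [Field K] [CharP K p] :
    IsGreenSequence p (δ K) where
  zero := δ_zero
  one := δ_one
  mul_block e a u h := δ_mul_δ_mul p h u
  succ_mul_succ e a u h := δ_succ_mul_δ p h u
  succ_mul_block e m hm := by
    obtain ⟨r, hr⟩ : ∃ r, p ^ e = r + 1 :=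
      Nat.exists_eq_add_one.2 (pow_pos (by omega) e)
    rw [δ_succ_mul_δ_mul p hr (natCast_succ_ne_zero hm)]
    have : (p : EndoRing K) ^ e = r + 1 := by exact_mod_cast congrArg (Nat.cast (R := EndoRing K)) hr
    rw [this]
    ring
  fusion e m hm := by
    -- For q = 1 the coefficient q - 2 = -1 cancels one of the two copies of δ_{m+1}, and the rule
    -- reduces to the previous one.
    rcases Nat.eq_zero_or_pos e with rfl | he
    · have h := δ_succ_mul_δ_mul p (K := K) (r := 0) (e := 0) (m := m + 1) (by simp)
        (natCast_succ_ne_zero hm)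
      simp only [pow_zero, one_mul] at h ⊢
      rw [h]
      push_cast
      ring
    · obtain ⟨r, hr⟩ : ∃ r, p ^ e = r + 2 := exists_pow_eq_add_two hp he
      rw [δ_fusion p hr (natCast_succ_ne_zero (by omega)) (by
        have := natCast_succ_ne_zero (K := K) hm
        push_cast at this
        rwa [add_assoc, one_add_one_eq_two] at this)]
      have : (p : EndoRing K) ^ e = r + 2 := by
        exact_mod_cast congrArg (Nat.cast (R := EndoRing K)) hr
      rw [this, show p ^ e - 1 = r + 1 by omega]
      ring
  fusion_last e m hm := by
    rcases Nat.eq_zero_or_pos e with rfl | he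
    · have h := δ_mul_δ_mul p (K := K) (a := 2) (e := 1) (by rw [pow_one]; omega) 1
      simp only [pow_zero, one_mul, mul_one, pow_one] at h ⊢
      rw [← hm] at h
      rw [h]
      push_cast
      ring
    · obtain ⟨r, hr⟩ : ∃ r, p ^ e = r + 2 := exists_pow_eq_add_two hp he
      rw [δ_fusion_last p hr (natCast_succ_ne_zero (by omega)) hm]
      have : (p : EndoRing K) ^ e = r + 2 := by
        exact_mod_cast congrArg (Nat.cast (R := EndoRing K)) hr
      rw [this]
      ring

end EndoRing

/-! ### Fusion sequences and alternating differences -/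

/-- A sequence `μ 0, …, μ (p - 1)` with the fusion rules of the odd-dimensional representations. -/
structure IsFusionSequence (p : ℕ) {G : Type*} [CommRing G] (μ : ℕ → G) : Prop where
  zero : μ 0 = 1
  mul : ∀ m, m + 2 < p → μ 1 * μ (m + 1) = μ m + μ (m + 1) + μ (m + 2)
  mul_last : ∀ m, m + 2 = p → μ 1 * μ (m + 1) = μ m

/-- The last element acts as the reflection j ↦ p - 1 - j. The three-term rule is symmetric under
this reflection, so induction on j applies. -/
theorem IsFusionSequence.last_mul {p : ℕ} {G : Type*} [CommRing G] {μ : ℕ → G}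
    (h : IsFusionSequence p μ) (hp : 2 ≤ p) (j : ℕ) (hj : j < p) :
    μ (p - 1) * μ j = μ (p - 1 - j) := by
  induction j using Nat.strong_induction_on with
  | _ j ih =>
    rcases j with _ | _ | j
    · simp [h.zero]
    · have := h.mul_last (p - 2) (by omega)
      rw [show p - 2 + 1 = p - 1 by omega] at this
      rw [mul_comm, zero_add, this]
      congr 1
    · have h1 := ih j (by omega) (by omega)
      have h2 := ih (j + 1) (by omega) (by omega)
      have h3 := h.mul j (by omega)
      have h4 := h.mul (p - 1 - (j + 1 + 1)) (by omega)
      rw [show p - 1 - (j + 1 + 1) + 1 = p - 1 - (j + 1) by omega,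
        show p - 1 - (j + 1 + 1) + 2 = p - 1 - j by omega] at h4
      linear_combination (-μ (p - 1)) * h3 + (μ 1 - 1) * h2 - h1 + h4

/-- The virtual class `(-1) ^ k (δ (k + 1) - δ k)`. -/
def altDiff {G : Type*} [CommRing G] (δ : ℕ → G) (k : ℕ) : G := (-1) ^ k * (δ (k + 1) - δ k)

theorem altDiff_block {p : ℕ} {G : Type*} [CommRing G] (δ : ℕ → G) (hp : Odd p) (e j : ℕ) :
    altDiff δ (p ^ e * j) = (-1) ^ j * (δ (p ^ e * j + 1) - δ (p ^ e * j)) := by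
  rw [altDiff, pow_mul, (hp.pow).neg_one_pow]

namespace IsGreenSequence

variable {p : ℕ} {G : Type*} [CommRing G] {δ : ℕ → G} (h : IsGreenSequence p δ) (hp : Odd p)
  (hp2 : 2 < p)

include h

theorem altDiff_zero : altDiff δ 0 = 1 := by simp [altDiff, h.zero, h.one]

include hp

theorem altDiff_block_mul {e a : ℕ} (ha : a ≤ p ^ e) (j : ℕ) :
    altDiff δ (p ^ e * j) * δ a = (-1) ^ j * (δ (p ^ e * j + a) - δ (p ^ e * j)) := by
  rw [altDiff_block δ hp]
  rcases a with _ | a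
  · simp [h.zero]
  · have h1 := h.succ_mul_succ e a j ha
    have h2 := h.mul_block e (a + 1) j ha
    push_cast at h2
    linear_combination (-1) ^ j * h1 - (-1) ^ j * h2

/-- Splits λ along base-p digits: the part of an index below p^e separates as a factor. -/
theorem altDiff_block_mul_altDiff {e i : ℕ} (hi : i < p ^ e) (j : ℕ) :
    altDiff δ (p ^ e * j) * altDiff δ i = altDiff δ (p ^ e * j + i) := by
  rw [altDiff.eq_1 δ i, altDiff.eq_1 δ (p ^ e * j + i), mul_left_comm, mul_sub,
    h.altDiff_block_mul hp hi, h.altDiff_block_mul hp hi.le, pow_add, pow_mul,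
    (hp.pow).neg_one_pow, Nat.succ_eq_add_one, add_assoc]
  ring

/-- Expanding the differences, all multiples of δ_{q(m+1)} cancel except those that form λ_{q-1}
λ_{q(m+1)}. -/
theorem altDiff_pow_mul {e m : ℕ} (hm : m + 2 < p) :
    altDiff δ (p ^ e) * altDiff δ (p ^ e * (m + 1)) =
      altDiff δ (p ^ e * m) + altDiff δ (p ^ e - 1) * altDiff δ (p ^ e * (m + 1)) +
        altDiff δ (p ^ e * (m + 2)) := by
  have hpos : 0 < p ^ e := pow_pos hp.pos e
  have h1 := altDiff_block δ hp e 1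
  rw [mul_one, pow_one] at h1
  rw [mul_comm (altDiff δ (p ^ e - 1)), h.altDiff_block_mul_altDiff hp (by omega), h1,
    altDiff_block δ hp, altDiff_block δ hp, altDiff_block δ hp, altDiff, pow_add _ (p ^ e * (m + 1)),
    pow_mul, (hp.pow).neg_one_pow, (Nat.Odd.sub_odd hp.pow odd_one).neg_one_pow]
  have e1 : p ^ e * (m + 1) + (p ^ e - 1) + 1 = p ^ e * (m + 2) := by
    rw [add_assoc, Nat.sub_add_cancel hpos]; ring
  rw [e1]
  have f1 := h.fusion e m hm
  have f2 := h.succ_mul_block e m (by omega)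
  have f3 := h.mul_block e (p ^ e) (m + 1) le_rfl
  have f4 := h.succ_mul_succ e (p ^ e - 1) (m + 1) (by omega)
  rw [← add_assoc, e1, Nat.sub_add_cancel hpos, Nat.cast_sub hpos] at f4
  push_cast at f3 f4
  linear_combination (-1) ^ m * (f1 - f2 - f4 + f3)

theorem altDiff_pow_mul_last {e m : ℕ} (hm : m + 2 = p) :
    altDiff δ (p ^ e) * altDiff δ (p ^ e * (m + 1)) = altDiff δ (p ^ e * m) := by
  have hpos : 0 < p ^ e := pow_pos hp.pos e
  have h1 := altDiff_block δ hp e 1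
  rw [mul_one, pow_one] at h1
  rw [h1, altDiff_block δ hp, altDiff_block δ hp]
  have e1 : p ^ e * (m + 1) + (p ^ e - 1) + 1 = p ^ e * (m + 2) := by
    rw [add_assoc, Nat.sub_add_cancel hpos]; ring
  have f1 := h.fusion_last e m hm
  have f2 := h.succ_mul_block e m (by omega)
  have f3 := h.mul_block e (p ^ e) (m + 1) le_rfl
  have f4 := h.succ_mul_succ e (p ^ e - 1) (m + 1) (by omega)
  rw [← add_assoc, e1, Nat.sub_add_cancel hpos, Nat.cast_sub hpos] at f4
  push_cast at f3 f4
  linear_combination (-1) ^ m * (f1 - f2 - f4 + f3)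

/-- Twisting by powers of the involution ε = λ_{q-1} absorbs the factor ε in the middle term of
`altDiff_pow_mul`, and the rule becomes independent of e. -/
theorem isFusionSequence_of_sq {e : ℕ} (hε : altDiff δ (p ^ e - 1) ^ 2 = 1) :
    IsFusionSequence p fun j => altDiff δ (p ^ e - 1) ^ j * altDiff δ (p ^ e * j) where
  zero := by simp [h.altDiff_zero]
  mul m hm := by
    have := h.altDiff_pow_mul hp (e := e) hm
    simp only [mul_one]
    linear_combination altDiff δ (p ^ e - 1) ^ (m + 2) * this +
      (altDiff δ (p ^ e - 1) ^ m * altDiff δ (p ^ e * m) +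
        altDiff δ (p ^ e - 1) ^ (m + 1) * altDiff δ (p ^ e * (m + 1))) * hε
  mul_last m hm := by
    have := h.altDiff_pow_mul_last hp (e := e) hm
    simp only [mul_one]
    linear_combination altDiff δ (p ^ e - 1) ^ (m + 2) * this +
      (altDiff δ (p ^ e - 1) ^ m * altDiff δ (p ^ e * m)) * hε

include hp2

/-- Induction on e: the case a = q - 1 at level e says ε² = 1, which makes the twisted sequence
available. The top digit is then reflected by `IsFusionSequence.last_mul` and the lower digits by
the inductive hypothesis. -/
theorem altDiff_last_mul (e : ℕ) {a : ℕ} (ha : a < p ^ e) :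
    altDiff δ (p ^ e - 1) * altDiff δ a = altDiff δ (p ^ e - 1 - a) := by
  induction e generalizing a with
  | zero =>
    obtain rfl : a = 0 := by simpa using ha
    simp [h.altDiff_zero]
  | succ e ih =>
    have hpos : 0 < p ^ e := pow_pos hp.pos e
    have hε : altDiff δ (p ^ e - 1) ^ 2 = 1 := by
      rw [pow_two, ih (by omega), Nat.sub_self, h.altDiff_zero]
    have hμ := h.isFusionSequence_of_sq hp hε
    obtain ⟨j, i, hi, rfl⟩ : ∃ j i, i < p ^ e ∧ a = p ^ e * j + i :=
      ⟨a / p ^ e, a % p ^ e, Nat.mod_lt _ hpos, (Nat.div_add_mod _ _).symm⟩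
    have hj : j < p := by
      rw [pow_succ] at ha
      exact lt_of_mul_lt_mul_left (by omega : p ^ e * j < p ^ e * p) (Nat.zero_le _)
    have e1 : p ^ (e + 1) - 1 = p ^ e * (p - 1) + (p ^ e - 1) := by
      obtain ⟨s, rfl⟩ : ∃ s, p = s + 1 := ⟨p - 1, by omega⟩
      rw [pow_succ, Nat.add_sub_cancel, ← Nat.add_sub_assoc hpos]
      congr 1
    have e2 : p ^ (e + 1) - 1 - (p ^ e * j + i) = p ^ e * (p - 1 - j) + (p ^ e - 1 - i) := by
      obtain ⟨s, hs⟩ : ∃ s, p - 1 = j + s := ⟨p - 1 - j, by omega⟩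
      rw [e1, hs, Nat.add_sub_cancel_left, mul_add]
      omega
    rw [e2, e1, ← h.altDiff_block_mul_altDiff hp hi, ← h.altDiff_block_mul_altDiff hp (by omega),
      ← h.altDiff_block_mul_altDiff hp (by omega), ← ih hi]
    have hl := hμ.last_mul (by omega) j hj
    beta_reduce at hl
    have hodd : Even (p - 1) := Nat.Odd.sub_odd hp odd_one
    obtain ⟨s, hs⟩ := hodd
    have h2 : altDiff δ (p ^ e - 1) ^ (p - 1) = 1 := by
      rw [hs, ← two_mul, pow_mul, hε, one_pow]
    have h3 : altDiff δ (p ^ e - 1) ^ (p - 1 - j) * altDiff δ (p ^ e - 1) ^ j = 1 := by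
      rw [← pow_add, Nat.sub_add_cancel (by omega), h2]
    have h4 : altDiff δ (p ^ e - 1) ^ j * altDiff δ (p ^ e - 1) ^ j = 1 := by
      rw [← mul_pow, ← pow_two, hε, one_pow]
    rw [h2, one_mul] at hl
    linear_combination (altDiff δ (p ^ e - 1) ^ j * altDiff δ (p ^ e - 1) * altDiff δ i) * hl +
      (altDiff δ (p ^ e - 1) * altDiff δ i) * altDiff δ (p ^ e * (p - 1 - j)) * h3 -
      altDiff δ (p ^ e * (p - 1)) * altDiff δ (p ^ e - 1) * altDiff δ (p ^ e * j) * altDiff δ i * h4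

theorem altDiff_last_sq (e : ℕ) : altDiff δ (p ^ e - 1) ^ 2 = 1 := by
  have hpos : 0 < p ^ e := pow_pos hp.pos e
  rw [pow_two, h.altDiff_last_mul hp hp2 e (by omega), Nat.sub_self, h.altDiff_zero]

/-- Telescoping of `altDiff_last_mul`; the signs match because q - 1 is even. -/
theorem altDiff_last_mul_δ (e : ℕ) {a : ℕ} (ha : a ≤ p ^ e) :
    altDiff δ (p ^ e - 1) * δ a = δ (p ^ e) - δ (p ^ e - a) := by
  induction a with
  | zero => simp [h.zero]
  | succ a ih =>
    have h1 := h.altDiff_last_mul hp hp2 e ha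
    rw [altDiff.eq_1 δ a, altDiff.eq_1 δ (p ^ e - 1 - a),
      show p ^ e - 1 - a + 1 = p ^ e - a by omega, Nat.sub_right_comm] at h1
    have h2 : (-1 : G) ^ (p ^ e - 1 - a) * (-1) ^ a = 1 := by
      rw [← pow_add, Nat.sub_add_cancel (by omega), (Nat.Odd.sub_odd hp.pow odd_one).neg_one_pow]
    have h3 : (-1 : G) ^ a * (-1) ^ a = 1 := by
      rw [← mul_pow]; simp
    rw [Nat.sub_right_comm] at h2
    have h4 := ih (by omega)
    rw [show p ^ e - (a + 1) = p ^ e - a - 1 by omega]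
    linear_combination (-1) ^ a * h1 + h4 + (δ (p ^ e - a) - δ (p ^ e - a - 1)) * h2 -
      altDiff δ (p ^ e - 1) * (δ (a + 1) - δ a) * h3

end IsGreenSequence

/-! ### The fusion matrix and the bound for B -/

section

open Polynomial

/-- The matrix of multiplication by `μ 1` on a fusion sequence. -/
def fusionMatrix (p : ℕ) : Matrix (Fin p) (Fin p) ℤ := fun k j =>
  (if (k : ℕ) + 1 = j then 1 else 0) + (if (j : ℕ) + 1 = k then 1 else 0) +
    if (k : ℕ) = j ∧ (k : ℕ) ≠ 0 ∧ (k : ℕ) + 1 ≠ p then 1 else 0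

/-- The polynomials expressing `μ k` through `μ 1` in a fusion sequence. -/
noncomputable def fusionPoly : ℕ → ℤ[X]
  | 0 => 1
  | 1 => X
  | k + 2 => (X - 1) * fusionPoly (k + 1) - fusionPoly k

theorem IsFusionSequence.aeval_fusionPoly {p : ℕ} {G : Type*} [CommRing G] {μ : ℕ → G}
    (h : IsFusionSequence p μ) (k : ℕ) (hk : k < p) : aeval (μ 1) (fusionPoly k) = μ k := by
  induction k using Nat.strong_induction_on with
  | _ k ih =>
    rcases k with _ | _ | k
    · simp [fusionPoly, h.zero]
    · simp [fusionPoly]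
    · rw [fusionPoly, map_sub, map_mul, ih (k + 1) (by omega) (by omega), ih k (by omega) (by omega)]
      simp only [map_sub, aeval_X, map_one]
      linear_combination h.mul k hk

theorem Fin.sum_ite_val_eq {G : Type*} [AddCommMonoid G] (p c : ℕ) (f : ℕ → G) :
    ∑ l : Fin p, (if (l : ℕ) = c then f l else 0) = if c < p then f c else 0 := by
  split_ifs with h
  · rw [Finset.sum_eq_single ⟨c, h⟩] <;> simp +contextual [Fin.ext_iff]
  · exact Finset.sum_eq_zero fun l _ => if_neg (by omega)

theorem IsFusionSequence.sum_fusionMatrix {p : ℕ} (hp : 2 ≤ p) {G : Type*} [CommRing G] {μ : ℕ → G}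
    (h : IsFusionSequence p μ) (j : Fin p) :
    ∑ k, (fusionMatrix p k j : G) * μ k = μ 1 * μ j := by
  have h1 (k : Fin p) : (fusionMatrix p k j : G) * μ k =
      (if (k : ℕ) = j - 1 then (if (j : ℕ) = 0 then 0 else μ k) else 0) +
      (if (k : ℕ) = j + 1 then μ k else 0) +
      (if (k : ℕ) = j then (if (j : ℕ) = 0 ∨ (j : ℕ) + 1 = p then 0 else μ k) else 0) := by
    unfold fusionMatrix
    push_cast
    split_ifs <;> first | omega | simp
  rw [Finset.sum_congr rfl fun k _ => h1 k, Finset.sum_add_distrib, Finset.sum_add_distrib,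
    Fin.sum_ite_val_eq p _ (fun k => if (j : ℕ) = 0 then 0 else μ k), Fin.sum_ite_val_eq,
    Fin.sum_ite_val_eq p _ (fun k => if (j : ℕ) = 0 ∨ (j : ℕ) + 1 = p then 0 else μ k)]
  obtain ⟨j, hj⟩ := j
  simp only
  rcases j with _ | j
  · rw [if_pos (by omega : 0 + 1 < p)]
    simp [h.zero]
  · rcases Nat.lt_or_ge (j + 2) p with h2 | h2
    · rw [h.mul j h2]
      simp [h2, h2.ne, show j < p by omega, hj, add_assoc]
      abel
    · obtain rfl : j + 2 = p := by omega
      rw [h.mul_last j rfl]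
      simp

/-- The μ_k need not be linearly independent, so coordinates are read off the integer matrix; they
depend only on p and the polynomial, not on the ring. -/
theorem IsFusionSequence.sum_aeval {p : ℕ} (hp : 2 ≤ p) {G : Type*} [CommRing G] {μ : ℕ → G}
    (h : IsFusionSequence p μ) (P : ℤ[X]) (j : Fin p) :
    ∑ k, ((aeval (fusionMatrix p) P k j : ℤ) : G) * μ k = aeval (μ 1) P * μ j := by
  induction P using Polynomial.induction_on' generalizing j with
  | add P Q hP hQ =>
    simp only [map_add, Matrix.add_apply, Int.cast_add, add_mul, Finset.sum_add_distrib, hP, hQ]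
  | monomial n a =>
    have h1 (k : Fin p) : aeval (fusionMatrix p) (monomial n a) k j =
        a * (fusionMatrix p ^ n) k j := by
      rw [aeval_monomial, ← Algebra.smul_def]
      rfl
    have h2 : ∑ k, (((fusionMatrix p ^ n) k j : ℤ) : G) * μ k = μ 1 ^ n * μ j := by
      clear h1
      induction n generalizing j with
      | zero => simp [Matrix.one_apply]
      | succ n ih =>
        simp only [pow_succ, Matrix.mul_apply, Int.cast_sum, Finset.sum_mul, Int.cast_mul]
        rw [Finset.sum_comm, mul_assoc, ← h.sum_fusionMatrix hp, Finset.mul_sum]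
        refine Finset.sum_congr rfl fun l _ => ?_
        rw [mul_left_comm, ← ih, Finset.mul_sum]
        exact Finset.sum_congr rfl fun i _ => by ring
    simp only [h1, Int.cast_mul, mul_assoc, ← Finset.mul_sum, h2]
    rw [aeval_monomial, mul_assoc]
    rfl

/-- The coefficient of `μ (p - 1)` in `P (μ 1)`, for a fusion sequence `μ`. -/
noncomputable def fusionCoeff (p : ℕ) [NeZero p] (P : ℤ[X]) : ℤ :=
  aeval (fusionMatrix p) P ⟨p - 1, Nat.sub_one_lt (NeZero.ne p)⟩ 0

/-- The triples occurring in the fusion rule. -/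
def FusionTriple (p i j k : ℕ) : Prop := i ≤ j + k ∧ j ≤ i + k ∧ k ≤ i + j ∧ i + j + k + 2 ≤ 2 * p

instance (p i j k : ℕ) : Decidable (FusionTriple p i j k) := inferInstanceAs (Decidable (_ ∧ _))

theorem sum_fusionMatrix_mul (p : ℕ) (k : Fin p) (f : ℕ → ℤ) :
    ∑ l : Fin p, fusionMatrix p k l * f l = (if (k : ℕ) + 1 < p then f (k + 1) else 0) +
      (if (k : ℕ) = 0 then 0 else f (k - 1)) +
      (if (k : ℕ) = 0 ∨ (k : ℕ) + 1 = p then 0 else f k) := by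
  have h1 (l : Fin p) : fusionMatrix p k l * f l =
      (if (l : ℕ) = k + 1 then f l else 0) +
      (if (l : ℕ) = k - 1 then (if (k : ℕ) = 0 then 0 else f l) else 0) +
      (if (l : ℕ) = k then (if (k : ℕ) = 0 ∨ (k : ℕ) + 1 = p then 0 else f l) else 0) := by
    unfold fusionMatrix
    split_ifs <;> omega
  rw [Finset.sum_congr rfl fun l _ => h1 l, Finset.sum_add_distrib, Finset.sum_add_distrib,
    Fin.sum_ite_val_eq, Fin.sum_ite_val_eq p _ (fun l => if (k : ℕ) = 0 then 0 else f l),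
    Fin.sum_ite_val_eq p _ (fun l => if (k : ℕ) = 0 ∨ (k : ℕ) + 1 = p then 0 else f l)]
  simp only [k.2, if_true, show (k : ℕ) - 1 < p by omega]

/-- A truncated Clebsch–Gordan rule for integer spins at level 2(p - 1), checked by the three-term
recursion. Its point is that multiplication by each μ_i has entries 0 and 1. -/
theorem aeval_fusionMatrix_fusionPoly {p : ℕ} (i : ℕ) (hi : i < p) (k j : Fin p) :
    aeval (fusionMatrix p) (fusionPoly i) k j = if FusionTriple p i j k then 1 else 0 := by
  induction i using Nat.strong_induction_on generalizing k j with
  | _ i ih =>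
    obtain ⟨j, hj⟩ := j
    have hk := k.2
    rcases i with _ | _ | i
    · simp only [fusionPoly, map_one, Matrix.one_apply, Fin.ext_iff, FusionTriple]
      split_ifs <;> omega
    · simp only [fusionPoly, aeval_X, fusionMatrix, FusionTriple]
      split_ifs <;> omega
    · rw [fusionPoly, map_sub, map_mul, Matrix.sub_apply, map_sub, aeval_X, map_one, sub_mul, one_mul,
        Matrix.sub_apply, Matrix.mul_apply, ih i (by omega) (by omega),
        ih (i + 1) (by omega) (by omega)]
      simp only [ih (i + 1) (by omega) (by omega)]
      rw [sum_fusionMatrix_mul p k (fun l => if FusionTriple p (i + 1) j l then 1 else 0)]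
      simp only [FusionTriple]
      rcases Nat.eq_zero_or_pos (k : ℕ) with h0 | h0
      · simp only [h0, true_or, if_true]
        split_ifs <;> omega
      · rcases Nat.lt_or_ge ((k : ℕ) + 1) p with h1 | h1
        · rw [if_pos h1, if_neg h0.ne', if_neg (by omega)]
          split_ifs <;> omega
        · rw [if_neg (by omega), if_neg h0.ne', if_pos (by omega)]
          split_ifs <;> omega

theorem Matrix.pow_entry_mem_Icc {p : ℕ} (E : Matrix (Fin p) (Fin p) ℤ)
    (hE : ∀ i j, 0 ≤ E i j ∧ E i j ≤ 1) (m : ℕ) (i j : Fin p) :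
    0 ≤ (E ^ (m + 1)) i j ∧ (E ^ (m + 1)) i j ≤ (p : ℤ) ^ m := by
  induction m generalizing i j with
  | zero => simpa using hE i j
  | succ m ih =>
    rw [pow_succ, Matrix.mul_apply]
    refine ⟨Finset.sum_nonneg fun l _ => mul_nonneg (ih i l).1 (hE l j).1, ?_⟩
    calc ∑ l, (E ^ (m + 1)) i l * E l j ≤ ∑ _l : Fin p, (p : ℤ) ^ m :=
          Finset.sum_le_sum fun l _ => (mul_le_of_le_one_right (ih i l).1 (hE l j).2).trans (ih i l).2
      _ = (p : ℤ) ^ (m + 1) := by simp [pow_succ']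

/-- In the matrix E of multiplication by μ_v, the last row and the first column each have a single
nonzero entry, equal to 1. The corner entry of E^n is therefore an entry of E^{n-2}; this saves the
two factors of p beyond the trivial bound p^{n-1}. -/
theorem fusionCoeff_pow_mem_Icc {p : ℕ} [NeZero p] {v n : ℕ} (hv : v < p) (hn : 3 ≤ n) :
    0 ≤ fusionCoeff p (fusionPoly v ^ n) ∧
      fusionCoeff p (fusionPoly v ^ n) ≤ (p : ℤ) ^ (n - 3) := by
  obtain ⟨m, rfl⟩ : ∃ m, n = m + 3 := Nat.exists_eq_add_of_le' hn
  set E := aeval (fusionMatrix p) (fusionPoly v) with hEdef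
  have hE (k j : Fin p) : E k j = if FusionTriple p v j k then 1 else 0 :=
    aeval_fusionMatrix_fusionPoly v hv k j
  have key : fusionCoeff p (fusionPoly v ^ (m + 3)) =
      (E ^ (m + 1)) ⟨p - 1 - v, by omega⟩ ⟨v, hv⟩ := by
    rw [fusionCoeff, map_pow, ← hEdef, pow_succ', Matrix.mul_apply,
      Finset.sum_eq_single ⟨p - 1 - v, by omega⟩]
    · rw [hE, if_pos (by simp only [FusionTriple]; omega), one_mul, pow_succ, Matrix.mul_apply,
        Finset.sum_eq_single ⟨v, hv⟩]
      · rw [hE, if_pos (by simp only [FusionTriple, Fin.val_zero]; omega), mul_one]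
      · intro l _ hl
        rw [hE, if_neg, mul_zero]
        simp only [FusionTriple, Fin.val_zero]
        rw [Ne, Fin.ext_iff] at hl
        simp only at hl
        omega
      · simp
    · intro l _ hl
      rw [hE, if_neg, zero_mul]
      simp only [FusionTriple]
      rw [Ne, Fin.ext_iff] at hl
      simp only at hl
      omega
    · simp
  rw [key, Nat.add_sub_cancel]
  refine Matrix.pow_entry_mem_Icc E (fun i j => ?_) m _ _
  rw [hE]
  split_ifs <;> simp

end

/-! ### The class of x^d and its recursion from q to pq -/

section

open Polynomial

/-- The class of `K[x] / (x ^ q)` with the endomorphism `x ^ d`. -/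
def powerClass {G : Type*} [CommRing G] (δ : ℕ → G) (d q : ℕ) : G :=
  ∑ r ∈ Finset.range d, δ ((q + r) / d)

/-- Hermite's identity. Raising q by one shifts the family of summands by one place. -/
theorem sum_range_add_div {d : ℕ} (hd : 0 < d) (q : ℕ) :
    ∑ r ∈ Finset.range d, (q + r) / d = q := by
  induction q with
  | zero =>
    refine Finset.sum_eq_zero fun r hr => ?_
    rw [zero_add, Nat.div_eq_of_lt (Finset.mem_range.1 hr)]
  | succ q ih =>
    have h1 := Finset.sum_range_succ (fun r => (q + r) / d) d
    have h2 := Finset.sum_range_succ' (fun r => (q + r) / d) d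
    rw [h1, ih, Nat.add_div_right _ hd] at h2
    simp only [add_zero] at h2
    have h3 : ∀ r, q + 1 + r = q + (r + 1) := fun r => by ring
    simp only [h3]
    omega

theorem add_div_le_self {d q r : ℕ} (hr : r < d) : (q + r) / d ≤ q := by
  rw [Nat.div_le_iff_le_mul_add_pred (by omega)]
  have := Nat.le_mul_of_pos_left q (show 0 < d by omega)
  omega

/-- Expansion of a power when `t` is a multiple of an idempotent absorbing the other factors. -/
theorem add_pow_of_absorbing {G : Type*} [CommRing G] {t a s m g : G} {q : G} {σ : G}
    (ht : t * t = q * t) (hg : t * g = q * t) (hs : t * s = σ * t) (k : ℕ) :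
    (t * a + s * m * g) ^ (k + 1) = s ^ (k + 1) * m ^ (k + 1) * g ^ (k + 1) +
      q ^ k * t * ((a + σ * m) ^ (k + 1) - σ ^ (k + 1) * m ^ (k + 1)) := by
  have hgk (j : ℕ) : t * g ^ j = q ^ j * t := by
    induction j with
    | zero => simp
    | succ j ih => linear_combination g * ih + q ^ j * hg
  have hsk (j : ℕ) : t * s ^ j = σ ^ j * t := by
    induction j with
    | zero => simp
    | succ j ih => linear_combination s * ih + σ ^ j * hs
  induction k with
  | zero => ring
  | succ k ih =>
    have h1 : t * (s ^ (k + 1) * g ^ (k + 1)) = q ^ (k + 1) * σ ^ (k + 1) * t := by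
      linear_combination g ^ (k + 1) * hsk (k + 1) + σ ^ (k + 1) * hgk (k + 1)
    have h2 : t * (s * g) = q * σ * t := by linear_combination g * hs + σ * hg
    rw [pow_succ, ih]
    linear_combination (a * m ^ (k + 1)) * h1 +
      (q ^ k * ((a + σ * m) ^ (k + 1) - σ ^ (k + 1) * m ^ (k + 1)) * m) * h2 +
      (q ^ k * ((a + σ * m) ^ (k + 1) - σ ^ (k + 1) * m ^ (k + 1)) * a) * ht

/-- The alternating sum of fusion polynomials. -/
noncomputable def fusionAltSum (u : ℕ) : ℤ[X] :=
  ∑ j ∈ Finset.range u, (-1) ^ j * fusionPoly j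

namespace IsGreenSequence

variable {p : ℕ} {G : Type*} [CommRing G] {δ : ℕ → G}

/-- The twisted classes `ε ^ j λ (p ^ e j)` with `ε = λ (p ^ e - 1)`. -/
def twist (p : ℕ) (δ : ℕ → G) (e j : ℕ) : G :=
  altDiff δ (p ^ e - 1) ^ j * altDiff δ (p ^ e * j)

variable (h : IsGreenSequence p δ) (hp : Odd p) (hp2 : 2 < p)

include h hp hp2

theorem isFusionSequence_twist (e : ℕ) : IsFusionSequence p (twist p δ e) :=
  h.isFusionSequence_of_sq hp (h.altDiff_last_sq hp hp2 e)

theorem altDiff_last_pow_even (e : ℕ) {k : ℕ} (hk : Even k) : altDiff δ (p ^ e - 1) ^ k = 1 := by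
  obtain ⟨j, rfl⟩ := hk
  rw [← two_mul, pow_mul, h.altDiff_last_sq hp hp2, one_pow]

theorem altDiff_block_eq_twist (e j : ℕ) :
    altDiff δ (p ^ e * j) = altDiff δ (p ^ e - 1) ^ j * twist p δ e j := by
  rw [twist, ← mul_assoc, ← pow_add, h.altDiff_last_pow_even hp hp2 e ⟨j, rfl⟩, one_mul]

/-- `altDiff_last_mul_δ` at a = q gives ε δ_q = δ_q - δ_0 = δ_q. -/
theorem δ_pow_mul_altDiff_last_pow (e j : ℕ) :
    δ (p ^ e) * altDiff δ (p ^ e - 1) ^ j = δ (p ^ e) := by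
  have := h.altDiff_last_mul_δ hp hp2 e le_rfl
  rw [Nat.sub_self, h.zero, sub_zero, mul_comm] at this
  induction j with
  | zero => simp
  | succ j ih => rw [pow_succ', ← mul_assoc, this, ih]

/-- The increments δ_{q(j+1)} - δ_{qj} equal (-1)^j λ_{qj} δ_q, and δ_q does not see the twist by ε.
-/
theorem δ_block (e : ℕ) {u : ℕ} (hu : u ≤ p) :
    δ (p ^ e * u) = δ (p ^ e) * aeval (twist p δ e 1) (fusionAltSum u) := by
  induction u with
  | zero => simp [h.zero, fusionAltSum]
  | succ u ih =>
    have h1 := h.altDiff_block_mul hp (le_refl (p ^ e)) u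
    have h2 := h.δ_pow_mul_altDiff_last_pow hp hp2 e u
    have h3 := (h.isFusionSequence_twist hp hp2 e).aeval_fusionPoly u (by omega)
    rw [h.altDiff_block_eq_twist hp hp2] at h1
    have h4 : ((-1 : G) ^ u) * (-1) ^ u = 1 := by rw [← mul_pow]; simp
    have h5 : p ^ e * (u + 1) = p ^ e * u + p ^ e := by ring
    rw [h5, fusionAltSum, Finset.sum_range_succ, ← fusionAltSum, map_add, map_mul, map_pow, map_neg,
      map_one, h3, mul_add (δ (p ^ e)), ← ih (by omega)]
    linear_combination (-(-1) ^ u) * h1 - (δ (p ^ e * u + p ^ e) - δ (p ^ e * u)) * h4 +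
      (-1) ^ u * twist p δ e u * h2

theorem δ_block_add {e b : ℕ} (hb : b ≤ p ^ e) (u : ℕ) :
    δ (p ^ e * u + b) = δ (p ^ e * u) +
      (-altDiff δ (p ^ e - 1)) ^ u * twist p δ e u * δ b := by
  have h1 := h.altDiff_block_mul hp hb u
  rw [h.altDiff_block_eq_twist hp hp2] at h1
  have h4 : ((-1 : G) ^ u) * (-1) ^ u = 1 := by rw [← mul_pow]; simp
  rw [neg_pow]
  linear_combination (-(-1) ^ u) * h1 - (δ (p ^ e * u + b) - δ (p ^ e * u)) * h4

theorem δ_block_sub {e b : ℕ} (hb : b ≤ p ^ e) (v : ℕ) :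
    δ (p ^ e * (v + 1) - b) = δ (p ^ e * (v + 1)) +
      (-altDiff δ (p ^ e - 1)) ^ (v + 1) * twist p δ e v * δ b := by
  have h1 := h.δ_block_add hp hp2 (Nat.sub_le (p ^ e) b) v
  have h2 := h.δ_block_add hp hp2 (le_refl (p ^ e)) v
  have h3 := h.altDiff_last_mul_δ hp hp2 e hb
  have e1 : p ^ e * (v + 1) = p ^ e * v + p ^ e := by ring
  rw [e1, Nat.add_sub_assoc hb]
  linear_combination h1 - h2 + (-altDiff δ (p ^ e - 1)) ^ v * twist p δ e v * h3

omit hp hp2 in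
-- Multiplication by δ_q replaces each block of size at most q by its dimension, and the sizes add
-- up to q.
theorem δ_pow_mul_powerClass {d : ℕ} (hd : 0 < d) (e : ℕ) :
    δ (p ^ e) * powerClass δ d (p ^ e) = (p : G) ^ e * δ (p ^ e) := by
  rw [powerClass, Finset.mul_sum]
  have h1 : ∀ r ∈ Finset.range d, δ (p ^ e) * δ ((p ^ e + r) / d) =
      (((p ^ e + r) / d : ℕ) : G) * δ (p ^ e) := fun r hr => by
    have := h.mul_block e ((p ^ e + r) / d) 1 (add_div_le_self (Finset.mem_range.1 hr))
    rwa [mul_one, mul_comm] at this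
  rw [Finset.sum_congr rfl h1, ← Finset.sum_mul, ← Nat.cast_sum, sum_range_add_div hd]
  push_cast
  rfl

theorem powerClass_succ_of_sub {d u : ℕ} (hd : 0 < d) (hu : p = d * u + 1) (e : ℕ) :
    powerClass δ d (p ^ (e + 1)) = d * δ (p ^ e * u) +
      (-altDiff δ (p ^ e - 1)) ^ u * twist p δ e u * powerClass δ d (p ^ e) := by
  have h1 : ∀ r ∈ Finset.range d, δ ((p ^ (e + 1) + r) / d) = δ (p ^ e * u) +
      (-altDiff δ (p ^ e - 1)) ^ u * twist p δ e u * δ ((p ^ e + r) / d) := fun r hr => by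
    rw [← h.δ_block_add hp hp2 (add_div_le_self (Finset.mem_range.1 hr))]
    have : p ^ (e + 1) + r = (p ^ e + r) + d * (p ^ e * u) := by
      rw [pow_succ]
      nth_rewrite 2 [hu]
      ring
    rw [this, Nat.add_mul_div_left _ _ hd, add_comm]
  rw [powerClass, Finset.sum_congr rfl h1, Finset.sum_add_distrib, ← Finset.mul_sum]
  simp [powerClass]

theorem powerClass_succ_of_add {d v : ℕ} (hd : 0 < d) (hv : p + 1 = d * (v + 1)) (e : ℕ) :
    powerClass δ d (p ^ (e + 1)) = d * δ (p ^ e * (v + 1)) +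
      (-altDiff δ (p ^ e - 1)) ^ (v + 1) * twist p δ e v * powerClass δ d (p ^ e) := by
  -- As pq = dq(v+1) - q, rounding turns around: the index d - 1 - r at level pq corresponds to r at
  -- level q. The sum is reflected accordingly.
  have h1 : ∀ r ∈ Finset.range d, δ ((p ^ (e + 1) + (d - 1 - r)) / d) = δ (p ^ e * (v + 1)) +
      (-altDiff δ (p ^ e - 1)) ^ (v + 1) * twist p δ e v * δ ((p ^ e + r) / d) := fun r hr => by
    have hr' := Finset.mem_range.1 hr
    have hle := add_div_le_self (q := p ^ e) hr'
    rw [← h.δ_block_sub hp hp2 hle]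
    congr 1
    have e1 : p ^ (e + 1) + p ^ e = d * (p ^ e * (v + 1)) := by
      rw [pow_succ, ← mul_add_one, hv]; ring
    have e2 : p ^ e ≤ p ^ e * (v + 1) := Nat.le_mul_of_pos_right _ (Nat.succ_pos v)
    have e3 := Nat.div_add_mod (p ^ e + r) d
    have e4 := Nat.mod_lt (p ^ e + r) hd
    rw [Nat.div_eq_iff hd]
    obtain ⟨w, hw⟩ : ∃ w, p ^ e * (v + 1) = (p ^ e + r) / d + w :=
      Nat.exists_eq_add_of_le (hle.trans e2)
    rw [hw, Nat.add_sub_cancel_left]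
    rw [hw, mul_add] at e1
    rw [mul_comm w d]
    omega
  rw [powerClass, ← Finset.sum_range_reflect, Finset.sum_congr rfl h1, Finset.sum_add_distrib,
    ← Finset.mul_sum]
  simp [powerClass]

theorem powerClass_succ {d u v : ℕ} (hd : 0 < d)
    (huv : (p = d * u + 1 ∧ v = u) ∨ (p + 1 = d * u ∧ v + 1 = u)) (e : ℕ) :
    powerClass δ d (p ^ (e + 1)) = d * δ (p ^ e * u) +
      (-altDiff δ (p ^ e - 1)) ^ u * twist p δ e v * powerClass δ d (p ^ e) := by
  rcases huv with ⟨hu, rfl⟩ | ⟨hu, rfl⟩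
  · exact h.powerClass_succ_of_sub hp hp2 hd hu e
  · exact h.powerClass_succ_of_add hp hp2 hd hu e

/-- `add_pow_of_absorbing` with t = δ_q, g = c_q and s = (-ε)^u. The parity hypothesis enters here:
it turns s^{n+1} and its sign into 1, so the polynomials left over do not depend on e. -/
theorem powerClass_succ_pow {d u v n : ℕ} (hd : 0 < d) (hup : u ≤ p) (hvp : v < p)
    (huv : (p = d * u + 1 ∧ v = u) ∨ (p + 1 = d * u ∧ v + 1 = u)) (hn : Even ((n + 1) * u)) (e : ℕ) :
    powerClass δ d (p ^ (e + 1)) ^ (n + 1) =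
      aeval (twist p δ e 1) (fusionPoly v ^ (n + 1)) * powerClass δ d (p ^ e) ^ (n + 1) +
      ((p : G) ^ n) ^ e * (aeval (twist p δ e 1) (((d : ℤ[X]) * fusionAltSum u + (-1) ^ u * fusionPoly v) ^ (n + 1)
        - fusionPoly v ^ (n + 1)) * δ (p ^ e)) := by
  have hε := h.δ_pow_mul_altDiff_last_pow hp hp2 e u
  have hv := (h.isFusionSequence_twist hp hp2 e).aeval_fusionPoly v hvp
  have ht := h.mul_block e (p ^ e) 1 le_rfl
  rw [mul_one, Nat.cast_pow] at ht
  have hs : δ (p ^ e) * (-altDiff δ (p ^ e - 1)) ^ u = (-1) ^ u * δ (p ^ e) := by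
    rw [neg_pow]
    linear_combination (-1) ^ u * hε
  have key := add_pow_of_absorbing (a := d * aeval (twist p δ e 1) (fusionAltSum u))
    (m := twist p δ e v) ht (h.δ_pow_mul_powerClass hd e) hs n
  have e1 : ((-altDiff δ (p ^ e - 1)) ^ u) ^ (n + 1) = 1 := by
    rw [← pow_mul, mul_comm, hn.neg_pow, h.altDiff_last_pow_even hp hp2 e hn]
  have e2 : ((-1 : G) ^ u) ^ (n + 1) = 1 := by rw [← pow_mul, mul_comm, hn.neg_one_pow]
  rw [e1, e2] at key
  rw [h.powerClass_succ hp hp2 hd huv, h.δ_block hp hp2 e hup, mul_left_comm, key]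
  simp only [map_sub, map_pow, map_add, map_mul, map_natCast, map_neg, map_one, hv]
  ring

section Functional

variable {θ : ℕ → G →+ ℤ}
  (hθ : ∀ Q k, k ≤ Q → 0 < Q → θ Q (δ k) = if k = Q then 1 else 0)

include hθ

/-- For even j the product is δ_{qj+a} - δ_{qj}; for odd j the extra ε turns it into δ_{qj+q-a} -
δ_{qj+q}. Since p - 1 is even, size pq is reached only at j = p - 1 and a = q. -/
theorem functional_twist_mul_δ {e a j : ℕ} (ha : a ≤ p ^ e) (hj : j < p) :
    θ (p ^ (e + 1)) (twist p δ e j * δ a) = if j = p - 1 ∧ a = p ^ e then 1 else 0 := by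
  have hpos : 0 < p ^ e := pow_pos hp.pos e
  have hpos' : 0 < p ^ (e + 1) := pow_pos hp.pos _
  have hodd : Even (p - 1) := Nat.Odd.sub_odd hp odd_one
  have hle (b : ℕ) (hb : b ≤ p ^ e) : p ^ e * j + b ≤ p ^ (e + 1) := by
    rw [pow_succ]
    have : p ^ e * (j + 1) ≤ p ^ e * p := Nat.mul_le_mul_left _ hj
    rw [mul_add] at this
    omega
  have heq (b : ℕ) (hb : b ≤ p ^ e) : p ^ e * j + b = p ^ (e + 1) ↔ j = p - 1 ∧ b = p ^ e := by
    rw [pow_succ]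
    constructor
    · intro hb'
      have hj' : j = p - 1 := by
        by_contra hne
        have : p ^ e * (j + 1 + 1) ≤ p ^ e * p := Nat.mul_le_mul_left _ (by omega)
        rw [mul_add, mul_add] at this
        omega
      refine ⟨hj', ?_⟩
      have : p ^ e * (j + 1) = p ^ e * p := by rw [hj', Nat.sub_add_cancel (by omega)]
      rw [mul_add] at this
      omega
    · rintro ⟨rfl, rfl⟩
      rw [← mul_add_one, Nat.sub_add_cancel (by omega)]
  have hval (b : ℕ) (hb : b ≤ p ^ e) :
      θ (p ^ (e + 1)) (δ (p ^ e * j + b)) = if j = p - 1 ∧ b = p ^ e then 1 else 0 := by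
    rw [hθ _ _ (hle b hb) hpos']
    simp only [heq b hb]
  rw [twist, mul_assoc]
  have h0 := hval 0 (Nat.zero_le _)
  rw [add_zero, if_neg (by omega)] at h0
  rcases Nat.even_or_odd j with hj2 | hj2
  · rw [h.altDiff_last_pow_even hp hp2 e hj2, one_mul, h.altDiff_block_mul hp ha, hj2.neg_one_pow,
      one_mul, map_sub, hval a ha, h0, sub_zero]
  · have hne : j ≠ p - 1 := by
      rintro rfl
      exact (Nat.not_even_iff_odd.2 hj2) hodd
    obtain ⟨i, hi⟩ := hj2
    have h1 : altDiff δ (p ^ e - 1) ^ j * (altDiff δ (p ^ e * j) * δ a) =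
        δ (p ^ e * j + (p ^ e - a)) - δ (p ^ e * j + p ^ e) := by
      have h2 := h.altDiff_last_mul_δ hp hp2 e ha
      have h3 := h.altDiff_last_pow_even hp hp2 e (k := 2 * i) ⟨i, two_mul i⟩
      have h4 := h.altDiff_block_mul hp (le_refl (p ^ e)) j
      have h5 := h.altDiff_block_mul hp (Nat.sub_le (p ^ e) a) j
      have h6 : (-1 : G) ^ j = -1 := Odd.neg_one_pow ⟨i, hi⟩
      have h7 : altDiff δ (p ^ e - 1) ^ j = altDiff δ (p ^ e - 1) := by
        rw [hi, pow_succ, h3, one_mul]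
      rw [h6] at h4 h5
      rw [h7]
      linear_combination altDiff δ (p ^ e * j) * h2 + h4 - h5
    rw [h1, map_sub, hval _ (Nat.sub_le _ _), hval _ le_rfl, if_neg (by tauto), if_neg (by tauto),
      if_neg (by tauto), sub_zero]

theorem functional_aeval_mul_δ [NeZero p] {e a : ℕ} (ha : a ≤ p ^ e) (P : ℤ[X]) :
    θ (p ^ (e + 1)) (aeval (twist p δ e 1) P * δ a) = if a = p ^ e then fusionCoeff p P else 0 := by
  have hμ := h.isFusionSequence_twist hp hp2 e
  have h1 := hμ.sum_aeval hp2.le P 0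
  rw [Fin.val_zero, hμ.zero, mul_one] at h1
  rw [← h1, Finset.sum_mul, map_sum]
  have h2 (k : Fin p) : θ (p ^ (e + 1)) (((aeval (fusionMatrix p) P k 0 : ℤ) : G) *
      twist p δ e k * δ a) = if k = ⟨p - 1, Nat.sub_one_lt (NeZero.ne p)⟩ then
        (if a = p ^ e then fusionCoeff p P else 0) else 0 := by
    rw [mul_assoc, ← zsmul_eq_mul, map_zsmul, h.functional_twist_mul_δ hp hp2 hθ ha k.2]
    by_cases hk : k = ⟨p - 1, Nat.sub_one_lt (NeZero.ne p)⟩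
    · subst hk
      simp [fusionCoeff]
    · rw [if_neg hk, if_neg, smul_zero]
      rw [Fin.ext_iff] at hk
      tauto
  rw [Finset.sum_congr rfl fun k _ => h2 k, Finset.sum_ite_eq' Finset.univ, if_pos (Finset.mem_univ _)]

/-- Of all the μ_k in the expansion of P(μ_1), only the last can create blocks of size pq, one for
each block of size q in x. The restriction to blocks of size at most q is essential. -/
theorem functional_aeval_mul [NeZero p] {e : ℕ} {x : G}
    (hx : x ∈ AddSubmonoid.closure (δ '' Set.Iic (p ^ e))) (P : ℤ[X]) :
    θ (p ^ (e + 1)) (aeval (twist p δ e 1) P * x) = fusionCoeff p P * θ (p ^ e) x := by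
  have hpos : 0 < p ^ e := pow_pos hp.pos e
  induction hx using AddSubmonoid.closure_induction with
  | mem x hx =>
    obtain ⟨a, ha, rfl⟩ := hx
    rw [h.functional_aeval_mul_δ hp hp2 hθ ha, hθ _ _ ha hpos]
    simp
  | zero => simp
  | add x y _ _ hx hy => rw [mul_add, map_add, hx, hy, map_add, mul_add]

/-- The recursion for the functionals on powers of `powerClass`. -/
theorem functional_powerClass_succ [NeZero p] {d u v n : ℕ} (hd : 0 < d) (hup : u ≤ p) (hvp : v < p)
    (huv : (p = d * u + 1 ∧ v = u) ∨ (p + 1 = d * u ∧ v + 1 = u)) (hn : Even ((n + 1) * u)) (e : ℕ)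
    (hmem : powerClass δ d (p ^ e) ^ (n + 1) ∈ AddSubmonoid.closure (δ '' Set.Iic (p ^ e))) :
    θ (p ^ (e + 1)) (powerClass δ d (p ^ (e + 1)) ^ (n + 1)) =
      fusionCoeff p (fusionPoly v ^ (n + 1)) * θ (p ^ e) (powerClass δ d (p ^ e) ^ (n + 1)) +
      ((p : ℤ) ^ n) ^ e * fusionCoeff p (((d : ℤ[X]) * fusionAltSum u + (-1) ^ u * fusionPoly v) ^ (n + 1)
        - fusionPoly v ^ (n + 1)) := by
  rw [h.powerClass_succ_pow hp hp2 hd hup hvp huv hn, map_add,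
    h.functional_aeval_mul hp hp2 hθ hmem]
  congr 1
  have : ((p : G) ^ n) ^ e = (((p ^ n) ^ e : ℕ) : G) := by push_cast; rfl
  rw [this, ← nsmul_eq_mul, map_nsmul, h.functional_aeval_mul_δ hp hp2 hθ le_rfl, if_pos rfl,
    nsmul_eq_mul]
  push_cast
  rfl

end Functional

end IsGreenSequence

end

/-! ### Nilpotent endomorphisms and the Fermat form in coordinates -/

section

open Polynomial

namespace EndoClass

variable {K : Type u} [Field K]

/-- A nilpotent endomorphism decomposes into Jordan blocks. -/
theorem exists_mk_eq_sum_jordan {V : Type u} [AddCommGroup V] [Module K V] [FiniteDimensional K V]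
    (T : Module.End K V) {q : ℕ} (hT : T ^ q = 0) :
    ∃ (d : ℕ) (k : Fin d → ℕ), (∀ i, k i ≤ q) ∧ mk T = ∑ i, jordan K (k i) := by
  classical
  have : Module.Finite K (Module.AEval' T) := Module.Finite.equiv (Module.AEval'.of T)
  have : Module.Finite K[X] (Module.AEval' T) := Module.Finite.of_restrictScalars_finite K _ _
  have hXof (j : ℕ) (v : V) : (X ^ j : K[X]) • Module.AEval'.of T v =
      Module.AEval'.of T ((T ^ j) v) := by
    induction j generalizing v with
    | zero => simp
    | succ j ih => rw [pow_succ, mul_smul, Module.AEval'.X_smul_of, ih, pow_succ]; rfl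
  have htors : Module.IsTorsion' (Module.AEval' T) (Submonoid.powers (X : K[X])) := by
    intro x
    refine ⟨⟨X ^ q, q, rfl⟩, ?_⟩
    obtain ⟨v, rfl⟩ := (Module.AEval'.of T).surjective x
    change (X ^ q : K[X]) • Module.AEval'.of T v = 0
    rw [hXof, hT]
    simp
  obtain ⟨d, k, ⟨e⟩⟩ := Module.torsion_by_prime_power_decomposition
    (Polynomial.irreducible_X (R := K)) htors
  let e' : Module.AEval' T ≃ₗ[K[X]] ∀ i : Fin d, TruncPoly K (k i) :=
    e.trans (DirectSum.linearEquivFunOnFintype K[X] (Fin d) _)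
  have hX (j : ℕ) (k : ℕ) (z : TruncPoly K k) : (X ^ j : K[X]) • z = TruncPoly.x K k ^ j * z := by
    rw [TruncPoly.x, ← map_pow]
    rfl
  refine ⟨d, k, fun i => ?_, ?_⟩
  · by_contra hi
    have h1 : (X ^ q : K[X]) • e'.symm (Pi.single i 1) = 0 := by
      obtain ⟨v, hv⟩ := (Module.AEval'.of T).surjective (e'.symm (Pi.single i 1))
      rw [← hv, hXof, hT]
      simp
    have h2 := congrFun (congrArg e' h1) i
    rw [map_smul, LinearEquiv.apply_symm_apply, Pi.smul_apply, Pi.single_eq_same, hX, mul_one,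
      map_zero] at h2
    exact TruncPoly.x_pow_ne_zero (not_le.1 hi) h2
  · unfold jordan
    rw [← mk_pi]
    refine mk_eq_mk ((Module.AEval'.of T).trans (e'.restrictScalars K)) fun v => ?_
    ext i
    change e' (Module.AEval'.of T (T v)) i = TruncPoly.x K (k i) * e' (Module.AEval'.of T v) i
    rw [← Module.AEval'.X_smul_of, map_smul, Pi.smul_apply]
    simpa using hX 1 (k i) (e' (Module.AEval'.of T v) i)

end EndoClass

namespace EndoRing

variable {K : Type u} [Field K]

theorem of_mk_mem_closure {V : Type u} [AddCommGroup V] [Module K V] [FiniteDimensional K V]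
    (T : Module.End K V) {q : ℕ} (hT : T ^ q = 0) :
    of (EndoClass.mk T) ∈ AddSubmonoid.closure (δ K '' Set.Iic q) := by
  obtain ⟨d, k, hk, h⟩ := EndoClass.exists_mk_eq_sum_jordan T hT
  rw [h, map_sum]
  exact AddSubmonoid.sum_mem _ fun i _ => AddSubmonoid.subset_closure ⟨k i, hk i, rfl⟩

/-- By Frobenius (S + T)^q = S^q + T^q = 0, so no block of the product exceeds q. This feeds the
membership hypothesis of `functional_powerClass_succ`. -/
theorem δ_mul_δ_mem_closure (p : ℕ) [Fact p.Prime] [CharP K p] {e a b : ℕ} (ha : a ≤ p ^ e)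
    (hb : b ≤ p ^ e) : δ K a * δ K b ∈ AddSubmonoid.closure (δ K '' Set.Iic (p ^ e)) := by
  obtain ⟨A, _, _, _, S, T, -, hS, hT, hmk, -⟩ := EndoClass.exists_jordan_mul_jordan_model K a b
  rw [δ, δ, ← map_mul, hmk]
  refine of_mk_mem_closure _ ?_
  rw [LinearMap.pow_mulLeft]
  rcases subsingleton_or_nontrivial A with _ | _
  · exact Subsingleton.elim _ _
  · have : CharP A p := charP_of_injective_algebraMap (algebraMap K A).injective p
    rw [add_pow_char_pow, pow_eq_zero_of_le ha hS, pow_eq_zero_of_le hb hT, zero_add,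
      LinearMap.mulLeft_zero_eq_zero]

theorem pow_mem_closure (p : ℕ) [Fact p.Prime] [CharP K p] {e : ℕ} {x : EndoRing K}
    (hx : x ∈ AddSubmonoid.closure (δ K '' Set.Iic (p ^ e))) (n : ℕ) :
    x ^ n ∈ AddSubmonoid.closure (δ K '' Set.Iic (p ^ e)) := by
  induction n with
  | zero =>
    rw [pow_zero, ← δ_one]
    exact AddSubmonoid.subset_closure ⟨1, Nat.one_le_pow _ _ (Fact.out (p := p.Prime)).pos, rfl⟩
  | succ n ih =>
    rw [pow_succ]
    generalize x ^ n = y at ih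
    induction ih, hx using AddSubmonoid.closure_induction₂ with
    | mem y x hy hx =>
      obtain ⟨a, ha, rfl⟩ := hy
      obtain ⟨b, hb, rfl⟩ := hx
      exact δ_mul_δ_mem_closure p ha hb
    | zero_left => rw [zero_mul]; exact AddSubmonoid.zero_mem _
    | zero_right => rw [mul_zero]; exact AddSubmonoid.zero_mem _
    | add_left _ _ _ _ _ _ h1 h2 => rw [add_mul]; exact AddSubmonoid.add_mem _ h1 h2
    | add_right _ _ _ _ _ _ h1 h2 => rw [mul_add]; exact AddSubmonoid.add_mem _ h1 h2

end EndoRing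

section Coordinates

variable (K : Type u) [Field K]

/-- Multiplication by `x ^ d` on `K[x] / (x ^ q)`, in coordinates. -/
def shiftEndo (q d : ℕ) : Module.End K (Fin q → K) where
  toFun w a := if d ≤ (a : ℕ) then w ⟨a - d, by omega⟩ else 0
  map_add' v w := by ext a; simp only [Pi.add_apply]; split_ifs <;> simp
  map_smul' c w := by ext a; simp only [Pi.smul_apply, RingHom.id_apply]; split_ifs <;> simp

/-- Multiplication by `x_i ^ d` on `K[x_1, …, x_n] / (x_1 ^ q, …, x_n ^ q)`, in coordinates. -/
def varPowEndo (n q d : ℕ) (i : Fin n) : Module.End K ((Fin n → Fin q) → K) where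
  toFun w a := if d ≤ (a i : ℕ) then w (Function.update a i ⟨a i - d, by omega⟩) else 0
  map_add' v w := by ext a; simp only [Pi.add_apply]; split_ifs <;> simp
  map_smul' c w := by ext a; simp only [Pi.smul_apply, RingHom.id_apply]; split_ifs <;> simp

/-- Multiplication by `∑ x_i ^ d` on `K[x_1, …, x_n] / (x_1 ^ q, …, x_n ^ q)`, in coordinates. -/
def fermatEndo (n q d : ℕ) : Module.End K ((Fin n → Fin q) → K) := ∑ i, varPowEndo K n q d i

variable {K}

theorem shiftEndo_pow_apply (q d k : ℕ) (w : Fin q → K) (a : Fin q) :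
    (shiftEndo K q d ^ k) w a = if h : d * k ≤ (a : ℕ) then w ⟨a - d * k, by omega⟩ else 0 := by
  induction k generalizing a with
  | zero => simp
  | succ k ih =>
    rw [pow_succ', Module.End.mul_apply]
    change (if d ≤ (a : ℕ) then (shiftEndo K q d ^ k) w ⟨a - d, by omega⟩ else 0) = _
    have hk : d * (k + 1) = d * k + d := mul_add_one d k
    split_ifs with h1 h2 h2
    · rw [ih, dif_pos (by simp only; omega)]
      congr 2
      simp only
      omega
    · rw [ih, dif_neg (by simp only; omega)]
    · omega
    · rfl

/-- The monomials split by exponent modulo d into chains. The chain starting at x^{d-1-r} has length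
⌊(q+r)/d⌋; if d - 1 - r ≥ q, both the vector and the size are zero. -/
theorem mk_shiftEndo {d : ℕ} (hd : 0 < d) (q : ℕ) :
    EndoClass.mk (shiftEndo K q d) =
      ∑ r ∈ Finset.range d, EndoClass.jordan K ((q + r) / d) := by
  rw [EndoClass.mk_eq_sum_jordan (ι := Fin d) (shiftEndo K q d)
    (fun r => fun a => if (a : ℕ) = d - 1 - r then 1 else 0) (fun r => (q + r) / d)]
  · exact Fin.sum_univ_eq_sum_range (fun r => EndoClass.jordan K ((q + r) / d)) d
  · intro r
    ext a
    rw [shiftEndo_pow_apply, Pi.zero_apply]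
    have h1 : q + r < d * ((q + r) / d + 1) := Nat.lt_mul_div_succ (q + r) hd
    rw [mul_add_one] at h1
    have h2 := a.2
    simp only
    split_ifs <;> first | rfl | omega
  · intro W hW hv
    have hW' (k : ℕ) (w : Fin q → K) (hw : w ∈ W) : (shiftEndo K q d ^ k) w ∈ W := by
      induction k with
      | zero => exact hw
      | succ k ih => rw [pow_succ']; exact hW _ ih
    refine eq_top_iff.2 fun w _ => ?_
    rw [pi_eq_sum_univ w]
    refine W.sum_mem fun i _ => W.smul_mem _ ?_
    have hi := Nat.mod_lt (i : ℕ) hd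
    convert hW' ((i : ℕ) / d) _ (hv ⟨d - 1 - (i : ℕ) % d, by omega⟩) using 1
    ext a
    rw [shiftEndo_pow_apply]
    have h1 := Nat.div_add_mod (i : ℕ) d
    simp only [Fin.ext_iff]
    split_ifs <;> first | rfl | omega
  · rw [Module.finrank_fin_fun, Fin.sum_univ_eq_sum_range (fun r => (q + r) / d),
      sum_range_add_div hd]

theorem mk_fermatEndo_succ (n q d : ℕ) :
    EndoClass.mk (fermatEndo K (n + 1) q d) =
      EndoClass.mk (shiftEndo K q d) * EndoClass.mk (fermatEndo K n q d) := by
  rw [EndoClass.mk_mul_mk]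
  symm
  let b := ((Pi.basisFun K (Fin q)).tensorProduct (Pi.basisFun K (Fin n → Fin q))).reindex
    (Fin.consEquiv fun _ => Fin q)
  have hb (v : Fin q → K) (w : (Fin n → Fin q) → K) (a : Fin (n + 1) → Fin q) :
      b.equivFun (v ⊗ₜ w) a = v (a 0) * w (Fin.tail a) := by
    rw [Module.Basis.equivFun_apply, Module.Basis.repr_reindex_apply]
    exact Module.Basis.tensorProduct_repr_tmul_apply _ _ v w _ _ |>.trans (by
      simp [mul_comm])
  refine EndoClass.mk_eq_mk b.equivFun fun z => ?_
  induction z with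
  | zero => simp only [map_zero]
  | add x y hx hy => rw [map_add, map_add, hx, hy, map_add, map_add]
  | tmul v w =>
    ext a
    rw [tensorEndo_tmul, map_add, Pi.add_apply, hb, hb]
    simp only [fermatEndo, LinearMap.sum_apply, Finset.sum_apply]
    rw [Fin.sum_univ_succ]
    congr 1
    · change (if d ≤ (a 0 : ℕ) then _ else 0) * _ = if d ≤ (a 0 : ℕ) then _ else 0
      split_ifs
      · rw [hb]; simp
      · simp
    · rw [Finset.mul_sum]
      refine Finset.sum_congr rfl fun i _ => ?_
      change v (a 0) * (if d ≤ (Fin.tail a i : ℕ) then _ else 0) =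
        if d ≤ (a i.succ : ℕ) then _ else 0
      change v (a 0) * (if d ≤ (a i.succ : ℕ) then _ else 0) = _
      split_ifs
      · rw [hb]
        congr 2
        ext j
        rcases eq_or_ne j i with rfl | hj
        · simp [Fin.tail]
        · simp [Fin.tail, hj, Function.update_of_ne]
      · simp

theorem mk_fermatEndo (n q d : ℕ) :
    EndoClass.mk (fermatEndo K n q d) = EndoClass.mk (shiftEndo K q d) ^ n := by
  induction n with
  | zero =>
    rw [pow_zero, EndoClass.one_eq]
    refine EndoClass.mk_eq_mk (LinearEquiv.funUnique (Fin 0 → Fin q) K K) fun w => ?_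
    simp [fermatEndo]
  | succ n ih => rw [mk_fermatEndo_succ, ih, pow_succ']

theorem finrank_range_fermatEndo_pow {d : ℕ} (hd : 0 < d) (n q j : ℕ) :
    (Module.finrank K (LinearMap.range (fermatEndo K n q d ^ j)) : ℤ) =
      EndoRing.rankPow j (powerClass (EndoRing.δ K) d q ^ n) := by
  have : powerClass (EndoRing.δ K) d q = EndoRing.of (EndoClass.mk (shiftEndo K q d)) := by
    rw [mk_shiftEndo hd, map_sum]
    rfl
  rw [this, ← map_pow, ← mk_fermatEndo, EndoRing.rankPow_of, EndoClass.rankPow_mk]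

end Coordinates

end

/-! ### Monomial coordinates over the ring of p^e-th powers -/

section FrobeniusBasis

open MvPowerSeries

variable (p e : ℕ) [Fact p.Prime] {K : Type u} [Field K] [CharP K p] {n : ℕ}

/-- A bounded exponent as an exponent. -/
noncomputable def boundedExp {q : ℕ} (a : Fin n → Fin q) : Fin n →₀ ℕ :=
  Finsupp.equivFunOnFinite.symm fun i => (a i : ℕ)

@[simp]
theorem boundedExp_apply {q : ℕ} (a : Fin n → Fin q) (i : Fin n) : boundedExp a i = a i := rfl

theorem exists_boundedExp_add_smul {q : ℕ} (hq : 0 < q) (m : Fin n →₀ ℕ) :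
    ∃ (a : Fin n → Fin q) (c : Fin n →₀ ℕ), m = boundedExp a + q • c := by
  refine ⟨fun i => ⟨m i % q, Nat.mod_lt _ hq⟩, Finsupp.equivFunOnFinite.symm fun i => m i / q, ?_⟩
  ext i
  simp [Nat.mod_add_div]

theorem coeff_smul_pow (t : MvPowerSeries (Fin n) K) (c : Fin n →₀ ℕ) :
    coeff (p ^ e • c) (t ^ p ^ e) = coeff c t ^ p ^ e := by
  have hp : p ≠ 0 := (Fact.out (p := p.Prime)).ne_zero
  rw [← map_iterateFrobenius_expand p hp, coeff_map, coeff_expand_smul, iterateFrobenius_def]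

theorem coeff_pow_of_not_dvd (t : MvPowerSeries (Fin n) K) {m : Fin n →₀ ℕ} {i : Fin n}
    (h : ¬ p ^ e ∣ m i) : coeff m (t ^ p ^ e) = 0 := by
  have hp : p ≠ 0 := (Fact.out (p := p.Prime)).ne_zero
  rw [← map_iterateFrobenius_expand p hp, coeff_map, coeff_expand_of_not_dvd _ _ _ h, map_zero]

theorem coeff_monomial_mul_pow (a b : Fin n → Fin (p ^ e)) (t : MvPowerSeries (Fin n) K)
    (c : Fin n →₀ ℕ) :
    coeff (boundedExp b + p ^ e • c) (monomial (boundedExp a) 1 * t ^ p ^ e) =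
      if a = b then coeff c t ^ p ^ e else 0 := by
  split_ifs with hab
  · subst hab
    rw [coeff_add_monomial_mul, one_mul, coeff_smul_pow]
  · rw [coeff_monomial_mul]
    split_ifs with hle
    · obtain ⟨i, hi⟩ := Function.ne_iff.1 hab
      rw [one_mul]
      refine coeff_pow_of_not_dvd p e t (i := i) ?_
      rintro ⟨k, hk⟩
      have h1 := hle i
      simp only [Finsupp.coe_tsub, Finsupp.coe_add, Finsupp.coe_smul, Pi.sub_apply, Pi.add_apply,
        Pi.smul_apply, boundedExp_apply, smul_eq_mul] at hk h1
      have h2 : (b i : ℕ) + p ^ e * c i = a i + p ^ e * k := by omega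
      have h3 := congrArg (· % p ^ e) h2
      simp only [Nat.add_mul_mod_self_left, Nat.mod_eq_of_lt (b i).2, Nat.mod_eq_of_lt (a i).2] at h3
      exact hi (Fin.ext h3.symm)
    · rfl

theorem coeff_sum_monomial_mul_pow (t : (Fin n → Fin (p ^ e)) → MvPowerSeries (Fin n) K)
    (b : Fin n → Fin (p ^ e)) (c : Fin n →₀ ℕ) :
    coeff (boundedExp b + p ^ e • c) (∑ a, monomial (boundedExp a) 1 * t a ^ p ^ e) =
      coeff c (t b) ^ p ^ e := by
  rw [map_sum, Finset.sum_congr rfl fun a _ => coeff_monomial_mul_pow p e a b (t a) c]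
  simp

variable [PerfectField K]

/-- The coordinate of `h` at `x ^ a` over the subring of `p ^ e`-th powers, as a `p ^ e`-th root. -/
noncomputable def frobCoord (a : Fin n → Fin (p ^ e)) (h : MvPowerSeries (Fin n) K) :
    MvPowerSeries (Fin n) K :=
  fun c => (iterateFrobeniusEquiv K p e).symm (coeff (boundedExp a + p ^ e • c) h)

theorem coeff_frobCoord (a : Fin n → Fin (p ^ e)) (h : MvPowerSeries (Fin n) K) (c : Fin n →₀ ℕ) :
    coeff c (frobCoord p e a h) =
      (iterateFrobeniusEquiv K p e).symm (coeff (boundedExp a + p ^ e • c) h) := rfl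

theorem sum_monomial_mul_frobCoord_pow (h : MvPowerSeries (Fin n) K) :
    ∑ a, monomial (boundedExp a) 1 * frobCoord p e a h ^ p ^ e = h := by
  ext m
  obtain ⟨b, c, rfl⟩ := exists_boundedExp_add_smul (pow_pos (Fact.out (p := p.Prime)).pos e) m
  rw [coeff_sum_monomial_mul_pow, coeff_frobCoord, ← iterateFrobeniusEquiv_def,
    RingEquiv.apply_symm_apply]

theorem frobCoord_sum (t : (Fin n → Fin (p ^ e)) → MvPowerSeries (Fin n) K)
    (b : Fin n → Fin (p ^ e)) :
    frobCoord p e b (∑ a, monomial (boundedExp a) 1 * t a ^ p ^ e) = t b := by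
  ext c
  rw [coeff_frobCoord, coeff_sum_monomial_mul_pow, ← iterateFrobeniusEquiv_def,
    RingEquiv.symm_apply_apply]

theorem frobCoord_add (a : Fin n → Fin (p ^ e)) (g h : MvPowerSeries (Fin n) K) :
    frobCoord p e a (g + h) = frobCoord p e a g + frobCoord p e a h := by
  ext c
  simp [coeff_frobCoord]

/-- This is the linearity over power series of the coordinates of a root, written without roots;
uniqueness of the expansion gives it. -/
theorem frobCoord_pow_mul (a : Fin n → Fin (p ^ e)) (s h : MvPowerSeries (Fin n) K) :
    frobCoord p e a (s ^ p ^ e * h) = s * frobCoord p e a h := by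
  have : s ^ p ^ e * h = ∑ a, monomial (boundedExp a) 1 * (s * frobCoord p e a h) ^ p ^ e := by
    nth_rewrite 1 [← sum_monomial_mul_frobCoord_pow p e h]
    rw [Finset.mul_sum]
    exact Finset.sum_congr rfl fun a _ => by ring
  rw [this, frobCoord_sum]

end FrobeniusBasis

/-! ### Power series modulo the q-th powers of the variables -/

section BoundedCoeff

open MvPowerSeries

variable (K : Type u) [Field K] (n q : ℕ)

/-- The coefficients at exponents with all entries below `q`. -/
noncomputable def boundedCoeff : MvPowerSeries (Fin n) K →ₗ[K] ((Fin n → Fin q) → K) :=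
  LinearMap.pi fun a => coeff (boundedExp a)

variable {K n q}

theorem boundedCoeff_apply (h : MvPowerSeries (Fin n) K) (a : Fin n → Fin q) :
    boundedCoeff K n q h a = coeff (boundedExp a) h := rfl

theorem boundedCoeff_surjective : Function.Surjective (boundedCoeff K n q) := by
  intro w
  refine ⟨∑ a, monomial (boundedExp a) (w a), ?_⟩
  ext b
  classical
  rw [boundedCoeff_apply, map_sum, Finset.sum_eq_single b]
  · exact coeff_monomial_same _ _
  · intro a _ hab
    refine coeff_monomial_ne (fun h => hab ?_) _
    ext i
    exact (DFunLike.congr_fun h i).symm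
  · simp

theorem boundedCoeff_fermat_mul (d : ℕ) (h : MvPowerSeries (Fin n) K) :
    boundedCoeff K n q (fermat K n d * h) = fermatEndo K n q d (boundedCoeff K n q h) := by
  rw [fermat, Finset.sum_mul, map_sum, fermatEndo, LinearMap.sum_apply]
  refine Finset.sum_congr rfl fun i _ => ?_
  ext a
  change coeff (boundedExp a) (X i ^ d * h) = if d ≤ (a i : ℕ) then coeff (boundedExp _) h else 0
  rw [X_pow_eq, coeff_monomial_mul, one_mul]
  have h1 : Finsupp.single i d ≤ boundedExp a ↔ d ≤ (a i : ℕ) := by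
    rw [Finsupp.single_le_iff]
    rfl
  simp only [h1]
  split_ifs with h2
  · congr 2
    ext j
    rcases eq_or_ne j i with rfl | hj
    · simp
    · simp [hj, Function.update_of_ne]
  · rfl

theorem boundedCoeff_fermat_pow_mul (d j : ℕ) (h : MvPowerSeries (Fin n) K) :
    boundedCoeff K n q (fermat K n d ^ j * h) =
      (fermatEndo K n q d ^ j) (boundedCoeff K n q h) := by
  induction j with
  | zero => simp
  | succ j ih =>
    rw [pow_succ', pow_succ', mul_assoc, boundedCoeff_fermat_mul, ih]
    rfl

theorem constantCoeff_frobCoord (p e : ℕ) [Fact p.Prime] [CharP K p] [PerfectField K]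
    (a : Fin n → Fin (p ^ e)) (h : MvPowerSeries (Fin n) K) :
    constantCoeff (frobCoord p e a h) =
      (iterateFrobeniusEquiv K p e).symm (boundedCoeff K n (p ^ e) h a) := by
  rw [← coeff_zero_eq_constantCoeff_apply, coeff_frobCoord, smul_zero, add_zero]
  rfl

end BoundedCoeff

/-! ### Free summands of the ring of roots -/

section FreeSummands

open MvPowerSeries

variable {K : Type u} [Field K] {n : ℕ} {f : MvPowerSeries (Fin n) K}

/-- The residue map of a hypersurface ring. -/
noncomputable def residueMap (hf : constantCoeff f = 0) : HypersurfaceRing f →+* K :=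
  Ideal.Quotient.lift _ constantCoeff fun a ha => by
    obtain ⟨b, rfl⟩ := Ideal.mem_span_singleton'.1 ha
    rw [map_mul, hf, mul_zero]

theorem residueMap_mk (hf : constantCoeff f = 0) (h : MvPowerSeries (Fin n) K) :
    residueMap hf (Ideal.Quotient.mk _ h) = constantCoeff h := rfl

theorem isUnit_of_residueMap (hf : constantCoeff f = 0) {r : HypersurfaceRing f}
    (hr : residueMap hf r ≠ 0) : IsUnit r := by
  obtain ⟨h, rfl⟩ := Ideal.Quotient.mk_surjective r
  rw [residueMap_mk] at hr
  exact (isUnit_iff_constantCoeff.2 (isUnit_iff_ne_zero.2 hr)).map _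

variable (p e : ℕ) [Fact p.Prime] [CharP K p]

/-- The `p ^ e`-th root of the class of a power series. -/
noncomputable def rootMk (f : MvPowerSeries (Fin n) K) :
    MvPowerSeries (Fin n) K →+* RootRing K (HypersurfaceRing f) p e :=
  Ideal.Quotient.mk (Ideal.span {f})

theorem mk_smul_rootMk (s h : MvPowerSeries (Fin n) K) :
    (Ideal.Quotient.mk (Ideal.span {f}) s : HypersurfaceRing f) • rootMk p e f h =
      rootMk p e f (s ^ p ^ e * h) := by
  rw [Algebra.smul_def, map_mul, map_pow]
  rfl

omit [Fact p.Prime] [CharP K p] in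
theorem rootMk_surjective : Function.Surjective (rootMk p e f) := Ideal.Quotient.mk_surjective

variable [PerfectField K]

/-- One half of the Fedder-type criterion: lift the map to power series, where it preserves
divisibility by f, and cancel one factor f. -/
theorem residueMap_apply_eq_zero (hf : constantCoeff f = 0) (hf0 : f ≠ 0)
    (φ : RootRing K (HypersurfaceRing f) p e →ₗ[HypersurfaceRing f] HypersurfaceRing f)
    {g : MvPowerSeries (Fin n) K} (hg : boundedCoeff K n (p ^ e) (f ^ (p ^ e - 1) * g) = 0) :
    residueMap hf (φ (rootMk p e f g)) = 0 := by
  have hq : 0 < p ^ e := pow_pos (Fact.out (p := p.Prime)).pos e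
  choose s hs using fun a : Fin n → Fin (p ^ e) =>
    Ideal.Quotient.mk_surjective (φ (rootMk p e f (monomial (boundedExp a) 1)))
  let φ' (h : MvPowerSeries (Fin n) K) : MvPowerSeries (Fin n) K := ∑ a, frobCoord p e a h * s a
  have hφ' (h : MvPowerSeries (Fin n) K) :
      Ideal.Quotient.mk (Ideal.span {f}) (φ' h) = φ (rootMk p e f h) := by
    nth_rewrite 2 [← sum_monomial_mul_frobCoord_pow p e h]
    rw [map_sum, map_sum, map_sum]
    refine Finset.sum_congr rfl fun a _ => ?_
    rw [mul_comm (monomial _ _), ← mk_smul_rootMk, map_smul, map_mul, hs, smul_eq_mul]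
  have hadd (g h : MvPowerSeries (Fin n) K) : φ' (g + h) = φ' g + φ' h := by
    simp only [φ', frobCoord_add, add_mul, Finset.sum_add_distrib]
  have hsum (t : (Fin n → Fin (p ^ e)) → MvPowerSeries (Fin n) K) :
      φ' (∑ a, t a) = ∑ a, φ' (t a) := map_sum (AddMonoidHom.mk' φ' hadd) t _
  have hpow (t h : MvPowerSeries (Fin n) K) : φ' (t ^ p ^ e * h) = t * φ' h := by
    simp only [φ', frobCoord_pow_mul, Finset.mul_sum, mul_assoc]
  have hdvd (h : MvPowerSeries (Fin n) K) : ∃ k, φ' (f * h) = f * k := by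
    have : Ideal.Quotient.mk (Ideal.span {f}) (φ' (f * h)) = 0 := by
      rw [hφ', map_mul]
      have : rootMk p e f f = 0 := Ideal.Quotient.eq_zero_iff_mem.2 (Ideal.mem_span_singleton_self f)
      rw [this, zero_mul, map_zero]
    obtain ⟨k, hk⟩ := Ideal.mem_span_singleton'.1 (Ideal.Quotient.eq_zero_iff_mem.1 this)
    exact ⟨k, by rw [← hk, mul_comm]⟩
  choose k hk using fun a : Fin n → Fin (p ^ e) => hdvd (monomial (boundedExp a) 1)
  set y := f ^ (p ^ e - 1) * g with hy
  -- Multiplying by f outside is multiplying by f^q = f · f^{q-1} inside. Expanding y = f^{q-1} g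
  -- over the monomials leaves one f under the lift, which comes out as a factor f.
  have h1 : f * φ' g = f * ∑ a, frobCoord p e a y * k a := by
    have h2 : f ^ p ^ e * g =
        ∑ a, frobCoord p e a y ^ p ^ e * (f * monomial (boundedExp a) 1) := by
      have h3 : f ^ p ^ e * g = f * y := by
        rw [hy, ← mul_assoc, ← pow_succ', Nat.sub_add_cancel hq]
      rw [h3]
      nth_rewrite 1 [← sum_monomial_mul_frobCoord_pow p e y]
      rw [Finset.mul_sum]
      exact Finset.sum_congr rfl fun a _ => by ring
    rw [← hpow, h2, hsum, Finset.mul_sum]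
    exact Finset.sum_congr rfl fun a _ => by rw [hpow, hk]; ring
  rw [← hφ', residueMap_mk, mul_left_cancel₀ hf0 h1, map_sum]
  refine Finset.sum_eq_zero fun a _ => ?_
  rw [map_mul, constantCoeff_frobCoord, hg, Pi.zero_apply, map_zero, zero_mul]

/-- Lift the basis of a free summand to g_b. A relation among the f^{q-1} g_b modulo (x_i^q) would
force every functional on Σ c_b^{1/q} g_b^{1/q} to be a nonunit, but the projection to the a-th
factor has residue c_a^{1/q}. -/
theorem le_of_hasFreeSummand {d m : ℕ} (hf : constantCoeff (fermat K n d) = 0)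
    (hf0 : fermat K n d ≠ 0)
    (hm : HasFreeSummand (HypersurfaceRing (fermat K n d))
      (RootRing K (HypersurfaceRing (fermat K n d)) p e) m) :
    m ≤ Module.finrank K (LinearMap.range (fermatEndo K n (p ^ e) d ^ (p ^ e - 1))) := by
  obtain ⟨i, r, hir⟩ := hm
  choose g hg using fun b : Fin m => rootMk_surjective p e (i (Pi.single b 1))
  have hφ (a b : Fin m) : r (rootMk p e (fermat K n d) (g b)) a = if a = b then 1 else 0 := by
    rw [hg, ← LinearMap.comp_apply, hir, LinearMap.id_apply, Pi.single_apply]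
  let w (b : Fin m) : LinearMap.range (fermatEndo K n (p ^ e) d ^ (p ^ e - 1)) :=
    ⟨_, boundedCoeff K n (p ^ e) (g b), rfl⟩
  have hw : LinearIndependent K w := by
    rw [Fintype.linearIndependent_iff]
    intro c hc a
    let c' (b : Fin m) : K := (iterateFrobeniusEquiv K p e).symm (c b)
    have hc' (b : Fin m) : c b = c' b ^ p ^ e := by
      rw [← iterateFrobeniusEquiv_def, RingEquiv.apply_symm_apply]
    have h1 : boundedCoeff K n (p ^ e) (fermat K n d ^ (p ^ e - 1) *
        ∑ b, (C (c' b)) ^ p ^ e * g b) = 0 := by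
      have h2 := congrArg Subtype.val hc
      rw [Submodule.coe_sum, Submodule.coe_zero] at h2
      rw [boundedCoeff_fermat_pow_mul, map_sum, map_sum, ← h2]
      refine Finset.sum_congr rfl fun b _ => ?_
      rw [← map_pow, ← hc', ← smul_eq_C_mul, map_smul, map_smul]
      rfl
    have h3 := residueMap_apply_eq_zero p e hf hf0 (LinearMap.proj a ∘ₗ r) h1
    rw [map_sum, map_sum, map_sum, Finset.sum_eq_single a] at h3
    · rw [← mk_smul_rootMk, map_smul, LinearMap.comp_apply, LinearMap.proj_apply, hφ, if_pos rfl,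
        smul_eq_mul, mul_one, residueMap_mk, constantCoeff_C] at h3
      rw [hc', h3, zero_pow (pow_pos (Fact.out (p := p.Prime)).pos e).ne']
    · intro b _ hb
      rw [← mk_smul_rootMk, map_smul, LinearMap.comp_apply, LinearMap.proj_apply, hφ,
        if_neg (Ne.symm hb), smul_zero, map_zero]
    · simp
  simpa using hw.fintype_card_le_finrank

/-- Every linear functional on bounded exponents gives a functional on the ring of roots. -/
theorem exists_functional (hf : constantCoeff f = 0) (ℓ : ((Fin n → Fin (p ^ e)) → K) →ₗ[K] K) :
    ∃ φ : RootRing K (HypersurfaceRing f) p e →ₗ[HypersurfaceRing f] HypersurfaceRing f,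
      ∀ g, residueMap hf (φ (rootMk p e f g)) =
        (iterateFrobeniusEquiv K p e).symm (ℓ (boundedCoeff K n (p ^ e) (f ^ (p ^ e - 1) * g))) := by
  classical
  have hq : 0 < p ^ e := pow_pos (Fact.out (p := p.Prime)).pos e
  let c (a : Fin n → Fin (p ^ e)) : K := (iterateFrobeniusEquiv K p e).symm (ℓ (Pi.single a 1))
  let F (h : MvPowerSeries (Fin n) K) : MvPowerSeries (Fin n) K :=
    ∑ a, C (c a) * frobCoord p e a (f ^ (p ^ e - 1) * h)
  have hadd (g h : MvPowerSeries (Fin n) K) : F (g + h) = F g + F h := by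
    simp only [F, mul_add, frobCoord_add, Finset.sum_add_distrib]
  have hpow (t h : MvPowerSeries (Fin n) K) : F (t ^ p ^ e * h) = t * F h := by
    simp only [F, Finset.mul_sum]
    refine Finset.sum_congr rfl fun a _ => ?_
    rw [mul_left_comm (f ^ _), frobCoord_pow_mul]
    ring
  let G : MvPowerSeries (Fin n) K →+ HypersurfaceRing f :=
    (Ideal.Quotient.mk (Ideal.span {f})).toAddMonoidHom.comp (AddMonoidHom.mk' F hadd)
  have hG (h : MvPowerSeries (Fin n) K) (hh : h ∈ Ideal.span {f}) : G h = 0 := by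
    obtain ⟨k, rfl⟩ := Ideal.mem_span_singleton'.1 hh
    change Ideal.Quotient.mk (Ideal.span {f}) (F (k * f)) = 0
    -- The factor f^{q-1} built into F meets f and becomes f^q, which comes out of the coordinates
    -- as f. Hence F descends to the quotient.
    have : F (k * f) = (∑ a, C (c a) * frobCoord p e a k) * f := by
      rw [mul_comm k, Finset.sum_mul]
      refine Finset.sum_congr rfl fun a _ => ?_
      rw [← mul_assoc, ← pow_succ, Nat.sub_add_cancel hq, frobCoord_pow_mul]
      ring
    rw [this]
    exact Ideal.Quotient.eq_zero_iff_mem.2 (Ideal.mul_mem_left _ _ (Ideal.mem_span_singleton_self f))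
  let φ₀ (x : RootRing K (HypersurfaceRing f) p e) : HypersurfaceRing f :=
    G (Function.surjInv (rootMk_surjective p e (f := f)) x)
  have hφ₀ (g : MvPowerSeries (Fin n) K) : φ₀ (rootMk p e f g) = G g := by
    rw [← sub_eq_zero, ← map_sub]
    exact hG _ (Ideal.Quotient.eq.1 (Function.surjInv_eq (rootMk_surjective p e (f := f)) _))
  let φ : RootRing K (HypersurfaceRing f) p e →ₗ[HypersurfaceRing f] HypersurfaceRing f :=
    { toFun := φ₀
      map_add' := fun x y => by
        obtain ⟨g, rfl⟩ := rootMk_surjective p e x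
        obtain ⟨h, rfl⟩ := rootMk_surjective p e y
        rw [← map_add, hφ₀, hφ₀, hφ₀, map_add]
      map_smul' := fun r y => by
        obtain ⟨s, rfl⟩ := Ideal.Quotient.mk_surjective r
        obtain ⟨h, rfl⟩ := rootMk_surjective p e y
        rw [mk_smul_rootMk, hφ₀, hφ₀, RingHom.id_apply, smul_eq_mul]
        change Ideal.Quotient.mk (Ideal.span {f}) (F _) = _ * Ideal.Quotient.mk (Ideal.span {f}) (F h)
        rw [hpow, map_mul] }
  refine ⟨φ, fun g => ?_⟩
  change residueMap hf (φ₀ (rootMk p e f g)) = _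
  rw [hφ₀]
  change constantCoeff (F g) = _
  rw [LinearMap.pi_apply_eq_sum_univ ℓ]
  simp only [F, map_sum, map_mul, constantCoeff_C, constantCoeff_frobCoord, smul_eq_mul, c]
  refine Finset.sum_congr rfl fun a _ => ?_
  rw [mul_comm]
  congr 3
  ext b
  simp [Pi.single_apply, eq_comm]

theorem hasFreeSummand_finrank {d : ℕ} (hf : constantCoeff (fermat K n d) = 0) :
    HasFreeSummand (HypersurfaceRing (fermat K n d))
      (RootRing K (HypersurfaceRing (fermat K n d)) p e)
      (Module.finrank K (LinearMap.range (fermatEndo K n (p ^ e) d ^ (p ^ e - 1)))) := by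
  classical
  set L := fermatEndo K n (p ^ e) d ^ (p ^ e - 1) with hL
  set D := Module.finrank K (LinearMap.range L) with hD
  let b := Module.finBasis K (LinearMap.range L)
  choose g hg using fun j : Fin D => show ∃ g, L (boundedCoeff K n (p ^ e) g) = b j by
    obtain ⟨w, hw⟩ := (b j).2
    obtain ⟨g, rfl⟩ := boundedCoeff_surjective w
    exact ⟨g, hw⟩
  choose ℓ hℓ using fun j : Fin D => LinearMap.exists_extend (b.coord j)
  choose φ hφ using fun j : Fin D => exists_functional p e hf (ℓ j)
  let M : Matrix (Fin D) (Fin D) (HypersurfaceRing (fermat K n d)) :=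
    fun j k => φ j (rootMk p e _ (g k))
  -- Evaluating the dual functionals on the lifted basis gives the identity over the residue field,
  -- so the determinant is a unit of the local ring and the summand splits.
  have hM : (residueMap hf).mapMatrix M = 1 := by
    ext j k
    rw [RingHom.mapMatrix_apply, Matrix.map_apply]
    simp only [M]
    rw [hφ, boundedCoeff_fermat_pow_mul, ← hL, hg]
    have h1 := LinearMap.congr_fun (hℓ j) (b k)
    rw [LinearMap.comp_apply, Submodule.subtype_apply] at h1
    rw [h1, Module.Basis.coord_apply, Module.Basis.repr_self, Finsupp.single_apply,
      Matrix.one_apply]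
    simp only [eq_comm (a := k)]
    split_ifs <;> simp
  have hdet : IsUnit M.det := by
    refine isUnit_of_residueMap hf ?_
    rw [RingHom.map_det, hM, Matrix.det_one]
    exact one_ne_zero
  refine ⟨Fintype.linearCombination _ fun k => rootMk p e _ (g k),
    Matrix.toLin' M⁻¹ ∘ₗ LinearMap.pi φ, ?_⟩
  have h1 : LinearMap.pi φ ∘ₗ Fintype.linearCombination (HypersurfaceRing (fermat K n d))
      (fun k => rootMk p e _ (g k)) = Matrix.toLin' M := by
    refine LinearMap.pi_ext' fun k => LinearMap.ext_ring ?_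
    ext j
    simp only [LinearMap.comp_apply, LinearMap.single_apply, LinearMap.pi_apply,
      Fintype.linearCombination_apply_single, one_smul]
    exact (congrFun (Matrix.mulVec_single_one M k) j).symm
  rw [LinearMap.comp_assoc, h1, ← Matrix.toLin'_mul, Matrix.nonsing_inv_mul _ hdet,
    Matrix.toLin'_one]

theorem FS_fermat_eq_finrank {d : ℕ} (hd : 0 < d) (hn : 0 < n) :
    FS p (fermat K n d) e =
      Module.finrank K (LinearMap.range (fermatEndo K n (p ^ e) d ^ (p ^ e - 1))) := by
  have hf : constantCoeff (fermat K n d) = 0 := by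
    simp [fermat, hd.ne']
  have hf0 : fermat K n d ≠ 0 := by
    intro h0
    have h1 := congrArg (coeff (Finsupp.single (⟨0, hn⟩ : Fin n) d)) h0
    rw [fermat, map_sum, Finset.sum_eq_single ⟨0, hn⟩] at h1
    · rw [X_pow_eq, coeff_monomial_same, map_zero] at h1
      exact one_ne_zero h1
    · intro i _ hi
      rw [X_pow_eq, coeff_monomial_ne]
      intro h2
      rw [Finsupp.single_left_inj hd.ne'] at h2
      exact hi h2.symm
    · simp
  exact IsGreatest.csSup_eq ⟨hasFreeSummand_finrank p e hf,
    fun m hm => le_of_hasFreeSummand p e hf hf0 hm⟩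

end FreeSummands

/-! ### The recursion and its solution -/

open Polynomial

/-- The recursion satisfied by the F-signature function of a Fermat hypersurface. -/
theorem FS_fermat_succ (p : ℕ) [Fact p.Prime] (hp2 : 2 < p) {d u v n : ℕ} (hd : 0 < d) (hup : u ≤ p)
    (hvp : v < p) (huv : (p = d * u + 1 ∧ v = u) ∨ (p + 1 = d * u ∧ v + 1 = u))
    (hn : Even ((n + 1) * u)) (K : Type u) [Field K] [CharP K p] [PerfectField K] (e : ℕ) :
    (FS p (fermat K (n + 1) d) (e + 1) : ℤ) =
      fusionCoeff p (fusionPoly v ^ (n + 1)) * FS p (fermat K (n + 1) d) e +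
      ((p : ℤ) ^ n) ^ e * fusionCoeff p (((d : ℤ[X]) * fusionAltSum u +
        (-1) ^ u * fusionPoly v) ^ (n + 1) - fusionPoly v ^ (n + 1)) := by
  have hodd : Odd p := (Fact.out (p := p.Prime)).odd_of_ne_two hp2.ne'
  rw [FS_fermat_eq_finrank p _ hd (Nat.succ_pos n), FS_fermat_eq_finrank p _ hd (Nat.succ_pos n),
    finrank_range_fermatEndo_pow hd, finrank_range_fermatEndo_pow hd]
  refine (EndoRing.isGreenSequence p hp2 K).functional_powerClass_succ hodd hp2
    (θ := fun Q => EndoRing.rankPow (Q - 1)) (fun Q k hk hQ => EndoRing.rankPow_δ hk hQ)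
    hd hup hvp huv hn e (EndoRing.pow_mem_closure p ?_ _)
  exact AddSubmonoid.sum_mem _ fun r hr => AddSubmonoid.subset_closure
    ⟨_, add_div_le_self (Finset.mem_range.1 hr), rfl⟩

theorem FS_fermat_zero (p : ℕ) [Fact p.Prime] {d n : ℕ} (hd : 0 < d) (hn : 0 < n)
    (K : Type u) [Field K] [CharP K p] [PerfectField K] : FS p (fermat K n d) 0 = 1 := by
  have h1 : powerClass (EndoRing.δ K) d 1 = 1 := by
    rw [powerClass, Finset.sum_eq_single (d - 1)]
    · rw [Nat.add_sub_cancel' hd, Nat.div_self hd, EndoRing.δ_one]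
    · intro r hr hne
      have := Finset.mem_range.1 hr
      rw [Nat.div_eq_of_lt (by omega), EndoRing.δ_zero]
    · intro h
      exact absurd (Finset.mem_range.2 (Nat.sub_one_lt hd.ne')) h
  have h2 := finrank_range_fermatEndo_pow (K := K) hd n 1 0
  rw [h1, one_pow, ← EndoRing.δ_one] at h2
  have h3 := EndoRing.rankPow_δ (K := K) (le_refl 1) one_pos
  rw [show EndoRing.rankPow 0 (EndoRing.δ K 1) = 1 from h3] at h2
  have h4 : ∀ q, q = 1 →
      Module.finrank K (LinearMap.range (fermatEndo K n q d ^ (q - 1))) = 1 := by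
    rintro _ rfl
    exact_mod_cast h2
  rw [FS_fermat_eq_finrank p 0 hd hn]
  exact h4 _ (pow_zero p)

/-- A first-order linear recursion with two exponentials, solved. -/
theorem eq_add_of_recursion {F : ℕ → ℚ} {P B C s : ℚ} (h0 : F 0 = 1)
    (hF : ∀ e, F (e + 1) = B * F e - C * P ^ e) (hs : s * (P - B) = -C) (e : ℕ) :
    F e = s * P ^ e + (1 - s) * B ^ e := by
  induction e with
  | zero => rw [h0]; ring
  | succ e ih =>
    rw [hF, ih]
    linear_combination (-P ^ e) * hs

theorem tendsto_div_of_eq_add {F : ℕ → ℝ} {P B s : ℝ} (hB : 0 ≤ B) (hBP : B < P)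
    (hF : ∀ e, F e = s * P ^ e + (1 - s) * B ^ e) :
    Filter.Tendsto (fun e => F e / P ^ e) Filter.atTop (nhds s) := by
  have hP : 0 < P := hB.trans_lt hBP
  have h1 : (fun e => F e / P ^ e) = fun e => s + (1 - s) * (B / P) ^ e := by
    ext e
    rw [hF, div_pow]
    field_simp
  rw [h1]
  have h2 := tendsto_pow_atTop_nhds_zero_of_lt_one (div_nonneg hB hP.le) ((div_lt_one hP).2 hBP)
  simpa using (h2.const_mul (1 - s)).const_add s

theorem theorem5p1 (p n d : ℕ) [Fact p.Prime] (hd : 2 ≤ d) (hdn : d < n) (hdp : d < p)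
    (hpar : (d ∣ p - 1 ∧ Even (n * ((p - 1) / d))) ∨ (d ∣ p + 1 ∧ Even (n * ((p + 1) / d)))) :
    ∃ B C : ℤ, 0 ≤ B ∧ B ≤ (p : ℤ) ^ (n - 3) ∧
      ∀ (K : Type*) [Field K] [CharP K p] [PerfectField K],
        ∃ s : ℚ, IsFSignature p (fermat K n d) (s : ℝ) ∧
          s = -(C : ℚ) / ((p : ℚ) ^ (n - 1) - (B : ℚ)) ∧
          ∀ e : ℕ, 1 ≤ e →
            (FS p (fermat K n d) e : ℚ) =
              s * (p : ℚ) ^ ((n - 1) * e) + (1 - s) * (B : ℚ) ^ e := by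
  have hp2 : 2 < p := by omega
  obtain ⟨u, v, hup, hvp, huv, hn⟩ : ∃ u v, u ≤ p ∧ v < p ∧
      ((p = d * u + 1 ∧ v = u) ∨ (p + 1 = d * u ∧ v + 1 = u)) ∧ Even (n * u) := by
    rcases hpar with ⟨⟨u, hu⟩, h⟩ | ⟨⟨u, hu⟩, h⟩
    · rw [hu, Nat.mul_div_cancel_left _ (by omega)] at h
      have h1 : u ≤ d * u := Nat.le_mul_of_pos_left u (by omega)
      exact ⟨u, u, by omega, by omega, Or.inl ⟨by omega, rfl⟩, h⟩
    · rw [hu, Nat.mul_div_cancel_left _ (by omega)] at h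
      have h1 : 2 * u ≤ d * u := Nat.mul_le_mul_right u hd
      have h2 : u ≠ 0 := by rintro rfl; simp at hu
      exact ⟨u, u - 1, by omega, by omega, Or.inr ⟨hu, by omega⟩, h⟩
  obtain ⟨N, rfl⟩ : ∃ N, n = N + 1 := ⟨n - 1, by omega⟩
  obtain ⟨hB0, hB⟩ := fusionCoeff_pow_mem_Icc (p := p) hvp (show 3 ≤ N + 1 by omega)
  have hrec := fun (K : Type _) [Field K] [CharP K p] [PerfectField K] (e : ℕ) =>
    FS_fermat_succ p hp2 (by omega) hup hvp huv hn K e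
  -- Both coefficients depend only on p, d and n, so they are fixed before the field is chosen; C is
  -- the negative of the second.
  generalize fusionCoeff p (fusionPoly v ^ (N + 1)) = B at hB0 hB hrec
  generalize fusionCoeff p (_ - _) = D at hrec
  -- Strictness comes from n - 3 < n - 1. It makes the denominator nonzero and (B/p^{n-1})^e tend to
  -- 0.
  have hBP : B < (p : ℤ) ^ N := hB.trans_lt (pow_lt_pow_right₀ (by omega) (by omega))
  have hBP' : (B : ℚ) < (p : ℚ) ^ N := by exact_mod_cast hBP
  refine ⟨B, -D, hB0, hB, fun K _ _ _ => ⟨(D : ℚ) / ((p : ℚ) ^ N - B), ?_, by simp, ?_⟩⟩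
  all_goals
    have key := eq_add_of_recursion (F := fun e => (FS p (fermat K (N + 1) d) e : ℚ))
      (P := (p : ℚ) ^ N) (B := B) (C := -D) (s := (D : ℚ) / ((p : ℚ) ^ N - B))
      (by simp [FS_fermat_zero p (show 0 < d by omega) (Nat.succ_pos N) K])
      (fun e => by
        have := congrArg (Int.cast (R := ℚ)) (hrec K e)
        push_cast at this
        rw [this]
        ring)
      (by rw [div_mul_cancel₀ _ (sub_pos.2 hBP').ne', neg_neg])
  · unfold IsFSignature
    simp only [Nat.add_sub_cancel, pow_mul]
    refine tendsto_div_of_eq_add (B := B) (by exact_mod_cast hB0) (by exact_mod_cast hBP) fun e => ?_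
    have := congrArg (Rat.cast (K := ℝ)) (key e)
    push_cast at this ⊢
    exact this
  · intro e _
    rw [Nat.add_sub_cancel, pow_mul]
    exact key e
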